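/- Let $M$ be a connected (Hausdorff, boundaryless) $C^\infty$-smooth manifold of dimension $n\ge 2$, let $f_1,\dots,f_s$ be $C^\infty$-smooth vector fields on $M$, and let $N\ge 1$. Consider the control-linear system $$\dot x=\sum_{j=1}^s f_j(x)\,u_j(t),\qquad u=(u_1,\dots,u_s)\in L_\infty([0,T],\mathbb R^s). \qquad (*)$$ Let $M^{(N)}$ be the set of injective $N$-point ensembles $\gamma=(\gamma_1,\dots,\gamma_N)\in M^N$, $\gamma_i\ne\gamma_k$ for $i\neq k$, with tangent spaces $T_\gamma M^{(N)}=T_{\gamma_1}M\times\cdots\times T_{\gamma_N}M$. The $N$-fold of a vector field $X$ on $M$ is the vector field $X^N(\gamma)=(X(\gamma_1),\dots,X(\gamma_N))$ on $M^{(N)}$, and the Lie bracket of $N$-folds is taken componentwise, $[X^N,Y^N]=[X,Y]^N$. The $N$-folds $f_1^N,\dots,f_s^N$ are *bracket generating at* $\gamma\in M^{(N)}$ if the values at $\gamma$ of all their iterated Lie brackets $[f^N_{j_1},[f^N_{j_2},\dots,[f^N_{j_{k-1}},f^N_{j_k}]\dots]]$, $k\ge1$ (for $k=1$ the fields $f_j^N$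 themselves), span $T_\gamma M^{(N)}$. For $T>0$ and $\alpha\in M^{(N)}$, the time-$T$ attainable set $\mathcal A_T(\alpha)$ is the set of all $\omega\in M^{(N)}$ for which there is one control $u\in L_\infty([0,T],\mathbb R^s)$ such that, for every $i=1,\dots,N$, the (Carathéodory) solution of $(*)$ starting at $\alpha_i$ at time $0$ exists on $[0,T]$ and is equal to $\omega_i$ at time $T$. (The vector fields are not assumed to be complete.) The system $(*)$ is *time-$T$ globally exactly controllable in the space of injective $N$-point ensembles* if $\mathcal A_T(\alpha)=M^{(N)}$ for every $\alpha\in M^{(N)}$. **Proposition.** If the $N$-folds $f_1^N,\dots,f_s^N$ are bracket generating at each point of $M^{(N)}$, then for every $T>0$ the system $(*)$ is time-$T$ globally exactly controllable in the space of injective $N$-point ensembles. -/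

import Mathlib

open scoped Manifold ContDiff Topology
open MeasureTheory Set

namespace EnsembleControl

/-- (Not necessarily smooth) vector fields on an `n`-dimensional manifold `M`. -/
abbrev VField (n : ℕ) (M : Type*) [TopologicalSpace M]
    [ChartedSpace (EuclideanSpace ℝ (Fin n)) M] : Type _ :=
  (x : M) → TangentSpace (𝓡 n) x

/-- A vector field is `C^∞`-smooth if it is smooth as a map `M → TM`. -/
def IsSmooth {n : ℕ} {M : Type*} [TopologicalSpace M]
    [ChartedSpace (EuclideanSpace ℝ (Fin n)) M] [IsManifold (𝓡 n) ∞ M]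
    (X : VField n M) : Prop :=
  ContMDiff (𝓡 n) (𝓡 n).tangent ∞ (fun x => (⟨x, X x⟩ : TangentBundle (𝓡 n) M))

/-- The space `M^(N)` of injective `N`-point ensembles: `N`-tuples of pairwise distinct points. -/
abbrev Ensemble (N : ℕ) (M : Type*) : Type _ := {γ : Fin N → M // Function.Injective γ}

/-- The iterated Lie brackets `[f_{j₁}, [f_{j₂}, … [f_{j_{k-1}}, f_{j_k}] … ]]`, `k ≥ 1`,
of the vector fields `f_1, …, f_s` (for `k = 1` these are the fields themselves). -/
inductive IsIteratedBracket {n s : ℕ} {M : Type*} [TopologicalSpace M]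
    [ChartedSpace (EuclideanSpace ℝ (Fin n)) M] (f : Fin s → VField n M) : VField n M → Prop
  | base (j : Fin s) : IsIteratedBracket f (f j)
  | bracket (j : Fin s) (X : VField n M) (hX : IsIteratedBracket f X) :
      IsIteratedBracket f (VectorField.mlieBracket (𝓡 n) (f j) X)

/-- The `N`-fold `X^N (x_1, …, x_N) = (X x_1, …, X x_N)` of a vector field `X`; its value at the
ensemble `γ` lies in `T_γ M^(N) = T_{γ_1} M × ⋯ × T_{γ_N} M`. -/
def nFold {n : ℕ} {M : Type*} [TopologicalSpace M] [ChartedSpace (EuclideanSpace ℝ (Fin n)) M]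
    {N : ℕ} (X : VField n M) (γ : Ensemble N M) : (i : Fin N) → TangentSpace (𝓡 n) (γ.1 i) :=
  fun i => X (γ.1 i)

/-- The `N`-folds of `f_1, …, f_s` are bracket generating at `γ ∈ M^(N)`: the values at `γ` of
their iterated Lie brackets span `T_γ M^(N)`. The Lie bracket of `N`-folds is componentwise,
`[X^N, Y^N] = [X, Y]^N`, so the iterated brackets of the `f_j^N` are the `N`-folds of the iterated
brackets of the `f_j`. -/
def NFoldsBracketGeneratingAt {n s : ℕ} {M : Type*} [TopologicalSpace M]
    [ChartedSpace (EuclideanSpace ℝ (Fin n)) M] {N : ℕ}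
    (f : Fin s → VField n M) (γ : Ensemble N M) : Prop :=
  Submodule.span ℝ
    {v : (i : Fin N) → TangentSpace (𝓡 n) (γ.1 i) |
      ∃ X : VField n M, IsIteratedBracket f X ∧ v = nFold X γ} = ⊤

/-- `x : [0,T] → M` is a (Carathéodory) solution on `[0,T]` of `ẋ = ∑ j, u_j(t) f_j(x)`:
it is continuous, absolutely continuous in every chart on every subinterval mapped into the
domain of this chart, and satisfies the equation for almost every `t ∈ [0,T]`.
The values of `x` and `u` outside `[0,T]` are irrelevant. -/
structure IsTrajectory {n s : ℕ} {M : Type*} [TopologicalSpace M]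
    [ChartedSpace (EuclideanSpace ℝ (Fin n)) M]
    (f : Fin s → VField n M) (T : ℝ) (u : ℝ → Fin s → ℝ) (x : ℝ → M) : Prop where
  continuousOn : ContinuousOn x (Icc 0 T)
  absolutelyContinuous : ∀ (p : M) (a b : ℝ), 0 ≤ a → a ≤ b → b ≤ T →
    MapsTo x (Icc a b) (extChartAt (𝓡 n) p).source →
      AbsolutelyContinuousOnInterval (fun t => extChartAt (𝓡 n) p (x t)) a b
  equation : ∀ᵐ t ∂(volume.restrict (Icc 0 T)),
    HasMFDerivAt 𝓘(ℝ, ℝ) (𝓡 n) x t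
      ((1 : ℝ →L[ℝ] ℝ).smulRight (∑ j, u t j • f j (x t) : TangentSpace (𝓡 n) (x t)))

/-- The ensemble `α` is steered to `β` in time `T` by the control `u`: for each `i` the solution
of `ẋ = ∑ j, u_j(t) f_j(x)` starting at `α_i` exists on `[0,T]` and equals `β_i` at time `T`. -/
def SteeredBy {n s : ℕ} {M : Type*} [TopologicalSpace M]
    [ChartedSpace (EuclideanSpace ℝ (Fin n)) M] {N : ℕ}
    (f : Fin s → VField n M) (T : ℝ) (u : ℝ → Fin s → ℝ) (α β : Ensemble N M) : Prop :=
  ∀ i : Fin N, ∃ x : ℝ → M, IsTrajectory f T u x ∧ x 0 = α.1 i ∧ x T = β.1 i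

/-- The time-`T` attainable set from `α`, with controls `u ∈ L_∞([0,T], ℝ^s)`; one and the same
control acts on all the points of the ensemble. -/
def attainableSet {n s : ℕ} {M : Type*} [TopologicalSpace M]
    [ChartedSpace (EuclideanSpace ℝ (Fin n)) M] {N : ℕ}
    (f : Fin s → VField n M) (T : ℝ) (α : Ensemble N M) : Set (Ensemble N M) :=
  {β | ∃ u : ℝ → Fin s → ℝ, MemLp u ⊤ (volume.restrict (Icc 0 T)) ∧ SteeredBy f T u α β}

/-- The system `ẋ = ∑ j, u_j(t) f_j(x)` is time-`T` globally exactly controllable in the space of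
injective `N`-point ensembles. -/
def GloballyExactlyControllable {n s : ℕ} {M : Type*} [TopologicalSpace M]
    [ChartedSpace (EuclideanSpace ℝ (Fin n)) M]
    (f : Fin s → VField n M) (N : ℕ) (T : ℝ) : Prop :=
  ∀ α : Ensemble N M, attainableSet f T α = Set.univ

end EnsembleControl

/-!
Chow's theorem for ensembles, with connectedness of the space of injective ensembles.

Ensembles that can be steered to one another by bounded controls form the classes of an equivalence
relation, `EnsembleControl.IsSteerable`: controls can be concatenated, and, since the system is
linear in the control, reversed and rescaled in time. By rescaling, the time is irrelevant, so that
it remains to show that there is only one class.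

*Classes are open* (`EnsembleControl.setOf_isSteerable_mem_nhds`). This is local, and is proved in
a product of charts, where the `N`-folds become vector fields `G j` on a vector space, made
compactly supported by a bump function. Consider the pairs `(y, W)` of a point `y` of the class and
the range `W` of the derivative of a map, with values in the class, through `y`
(`EnsembleControl.IsTangentAt`). The flow of `G j` carries `(y, W)` to a new pair, in which the
direction of `G j` may be added to the image of `W`, the time being a new parameter. If `W` has
maximal dimension, nothing can be added. So `G j` lies in `W` and in all its images under the flows,
and differentiating the pullback of a field by the flow shows that `W` contains the iterated
brackets too; see `EnsembleControl.mem_and_lieBracket_mem_of_forall_mem_map`. Thus `W` is the whole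
space, and the inverse function theorem gives a neighbourhood of `y` in the class, which the
reversed flows carry back to the initial point. This only needs the flow to be strictly
differentiable, which follows from Grönwall's inequality.

*There is one class* (`EnsembleControl.isSteerable_of_forall_mem_nhds`). When one point of an
ensemble moves and the others are fixed, the class is a locally constant function of the position
of the moving point, outside the finite set of the fixed points. In dimension at least two a small
punctured ball is connected, so that this function extends to a locally constant one on the
connected manifold, and is constant. Moving the points one by one joins any two ensembles without
common points, and two arbitrary ensembles are joined through a third one disjoint from both.
-/

namespace EnsembleControl

/-! ### Differentiability of local flows -/

section Flow

variable {E : Type*} [NormedAddCommGroup E] [NormedSpace ℝ E]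

/-- `Φ` is a flow of the vector field `X` for times in `(-ε, ε)`, defined at all points. -/
structure IsLocalFlow (X : E → E) (ε : ℝ) (Φ : ℝ → E → E) : Prop where
  pos : 0 < ε
  zero : ∀ x, Φ 0 x = x
  hasDerivAt : ∀ x, ∀ t ∈ Ioo (-ε) ε, HasDerivAt (fun τ => Φ τ x) (X (Φ t x)) t

/-- `A` solves the linearization of `ẋ = X x` along the curve `c`, with `A 0 = id`, for times in
`(-ε, ε)`. -/
structure IsVariationalSolution (X : E → E) (ε : ℝ) (c : ℝ → E) (A : ℝ → E →L[ℝ] E) :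
    Prop where
  zero : A 0 = ContinuousLinearMap.id ℝ E
  hasDerivAt : ∀ t ∈ Ioo (-ε) ε, HasDerivAt A ((fderiv ℝ X (c t)).comp (A t)) t

/-- A bounded Lipschitz vector field has a flow for any given time. -/
lemma exists_isLocalFlow [CompleteSpace E] {X : E → E} {K : NNReal} (hK : LipschitzWith K X)
    {L : ℝ} (hL : ∀ x, ‖X x‖ ≤ L) {ε : ℝ} (hε : 0 < ε) : ∃ Φ, IsLocalFlow X ε Φ := by
  have h0 : (0 : ℝ) ∈ Icc (-ε) ε := ⟨by linarith, hε.le⟩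
  have hex : ∀ x : E, ∃ α : ℝ → E, α 0 = x ∧
      ∀ t ∈ Icc (-ε) ε, HasDerivWithinAt α (X (α t)) (Icc (-ε) ε) t := by
    intro x
    have hL0 : 0 ≤ L := (norm_nonneg _).trans (hL x)
    have hpl : IsPicardLindelof (fun _ => X) (⟨0, h0⟩ : Icc (-ε) ε) x
        ⟨L * ε, by positivity⟩ 0 ⟨L, hL0⟩ K :=
      IsPicardLindelof.of_time_independent (fun y _ => hL y) hK.lipschitzOnWith (by simp; rfl)
    exact hpl.exists_eq_forall_mem_Icc_hasDerivWithinAt₀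
  choose α hα0 hα using hex
  exact ⟨fun t x => α x t, hε, hα0, fun x t ht =>
    (hα x t (Ioo_subset_Icc_self ht)).hasDerivAt (Icc_mem_nhds ht.1 ht.2)⟩

/-- The linearized equation is solvable for short times, with a bound that only depends on the
Lipschitz constant of the field. -/
lemma exists_isVariationalSolution [CompleteSpace E] {X : E → E} (hX : ContDiff ℝ 1 X)
    {K : NNReal} (hK : LipschitzWith K X) {ε : ℝ} (hε : 0 < ε) (hKε : 2 * K * ε ≤ 1) {δ : ℝ}
    (hδ : ε < δ) {c : ℝ → E} (hc : ContinuousOn c (Ioo (-δ) δ)) :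
    ∃ A, IsVariationalSolution X ε c A := by
  have h0 : (0 : ℝ) ∈ Icc (-ε) ε := ⟨by linarith, hε.le⟩
  have hsub : Icc (-ε) ε ⊆ Ioo (-δ) δ := fun t ht => ⟨by linarith [ht.1], by linarith [ht.2]⟩
  have hD : ∀ x, ‖fderiv ℝ X x‖ ≤ K := fun x => norm_fderiv_le_of_lipschitz ℝ hK
  have hpl : IsPicardLindelof (fun t (B : E →L[ℝ] E) => (fderiv ℝ X (c t)).comp B)
      (⟨0, h0⟩ : Icc (-ε) ε) (ContinuousLinearMap.id ℝ E) 1 0 (2 * K) K := by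
    constructor
    · intro t _
      refine LipschitzWith.lipschitzOnWith (LipschitzWith.of_dist_le_mul fun B B' => ?_)
      rw [dist_eq_norm, dist_eq_norm, ← ContinuousLinearMap.comp_sub]
      exact (ContinuousLinearMap.opNorm_comp_le _ _).trans (by gcongr; exact hD _)
    · intro B _
      exact ((hX.continuous_fderiv (by simp)).comp_continuousOn (hc.mono hsub)).clm_comp
        continuousOn_const
    · intro t _ B hB
      have hB2 : ‖B‖ ≤ 2 := by
        have h1 : ‖B - ContinuousLinearMap.id ℝ E‖ ≤ 1 := by simpa [dist_eq_norm] using hB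
        have h2 : ‖ContinuousLinearMap.id ℝ E‖ ≤ 1 := ContinuousLinearMap.norm_id_le
        calc ‖B‖ = ‖(B - ContinuousLinearMap.id ℝ E) + ContinuousLinearMap.id ℝ E‖ := by simp
          _ ≤ 1 + 1 := (norm_add_le _ _).trans (add_le_add h1 h2)
          _ = 2 := by norm_num
      calc ‖(fderiv ℝ X (c t)).comp B‖ ≤ ‖fderiv ℝ X (c t)‖ * ‖B‖ :=
            ContinuousLinearMap.opNorm_comp_le _ _
        _ ≤ K * 2 := by gcongr; exact hD _
        _ = _ := by push_cast; ring
    · simpa using hKε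
  obtain ⟨A, hA0, hA⟩ := hpl.exists_eq_forall_mem_Icc_hasDerivWithinAt₀
  exact ⟨A, hA0, fun t ht =>
    (hA t (Ioo_subset_Icc_self ht)).hasDerivAt (Icc_mem_nhds ht.1 ht.2)⟩

/-- The linear part at `q` approximates the increment of `X` from a different point `p`, up to
terms of second order. -/
lemma norm_sub_sub_fderiv_le {X : E → E} (hX : Differentiable ℝ X) {K₂ : NNReal}
    (hK₂ : LipschitzWith K₂ (fderiv ℝ X)) (p q h : E) :
    ‖X (p + h) - X p - fderiv ℝ X q h‖ ≤ K₂ * (‖p - q‖ + ‖h‖) * ‖h‖ := by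
  have := Convex.norm_image_sub_le_of_norm_fderiv_le' (𝕜 := ℝ) (f := X) (φ := fderiv ℝ X q)
    (s := Metric.closedBall q (‖p - q‖ + ‖h‖)) (x := p) (y := p + h)
    (C := K₂ * (‖p - q‖ + ‖h‖)) (fun x _ => hX x) (fun x hx => ?_) (convex_closedBall _ _)
    (by simp [dist_eq_norm])
    (by
      rw [mem_closedBall_iff_norm, add_sub_right_comm]
      exact norm_add_le _ _)
  · simpa using this
  · rw [← dist_eq_norm]
    refine (hK₂.dist_le_mul _ _).trans ?_
    gcongr
    exact hx

variable {X : E → E} {ε : ℝ} {Φ : ℝ → E → E}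

lemma IsLocalFlow.continuousOn (hΦ : IsLocalFlow X ε Φ) (x : E) :
    ContinuousOn (fun τ => Φ τ x) (Ioo (-ε) ε) :=
  fun t ht => (hΦ.hasDerivAt x t ht).continuousAt.continuousWithinAt

lemma IsLocalFlow.dist_le (hΦ : IsLocalFlow X ε Φ) {K : NNReal} (hK : LipschitzWith K X)
    (x y : E) {t : ℝ} (ht : t ∈ Ico 0 ε) :
    dist (Φ t x) (Φ t y) ≤ Real.exp (K * ε) * dist x y := by
  have hsub : Icc 0 t ⊆ Ioo (-ε) ε := fun τ hτ =>
    ⟨by linarith [hτ.1, ht.1, ht.2], by linarith [hτ.2, ht.2]⟩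
  have := dist_le_of_trajectories_ODE (v := fun _ => X) (K := K) (a := 0) (b := t)
    (f := fun τ => Φ τ x) (g := fun τ => Φ τ y) (δ := dist x y) (fun _ => hK)
    ((hΦ.continuousOn x).mono hsub)
    (fun τ hτ => (hΦ.hasDerivAt x τ (hsub (Ico_subset_Icc_self hτ))).hasDerivWithinAt)
    ((hΦ.continuousOn y).mono hsub)
    (fun τ hτ => (hΦ.hasDerivAt y τ (hsub (Ico_subset_Icc_self hτ))).hasDerivWithinAt)
    (by simp [hΦ.zero]) t ⟨ht.1, le_rfl⟩
  refine this.trans ?_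
  rw [mul_comm]
  gcongr
  simpa using ht.2.le

/-- The flow is continuous jointly in time and initial point. -/
lemma IsLocalFlow.continuousAt_uncurry (hΦ : IsLocalFlow X ε Φ) {K : NNReal}
    (hK : LipschitzWith K X) (x : E) {t : ℝ} (ht : t ∈ Ioo 0 ε) :
    ContinuousAt (fun p : ℝ × E => Φ p.1 p.2) (t, x) := by
  rw [ContinuousAt, tendsto_iff_dist_tendsto_zero]
  have h1 : ContinuousAt (fun p : ℝ × E => Φ p.1 x) (t, x) :=
    ContinuousAt.comp' (f := Prod.fst) (g := fun τ => Φ τ x)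
      (hΦ.hasDerivAt x t ⟨by linarith [ht.1, ht.2], ht.2⟩).continuousAt continuousAt_fst
  have h2 : Filter.Tendsto
      (fun p : ℝ × E => Real.exp (K * ε) * dist p.2 x + dist (Φ p.1 x) (Φ t x))
      (𝓝 (t, x)) (𝓝 0) := by
    have h3 : ContinuousAt
        (fun p : ℝ × E => Real.exp (K * ε) * dist p.2 x + dist (Φ p.1 x) (Φ t x)) (t, x) :=
      (continuousAt_const.mul (continuousAt_snd.dist continuousAt_const)).add
        (h1.dist continuousAt_const)
    simpa [ContinuousAt] using h3
  refine squeeze_zero' (.of_forall fun _ => dist_nonneg) ?_ h2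
  have h4 : ∀ᶠ p : ℝ × E in 𝓝 (t, x), p.1 ∈ Ioo 0 ε :=
    continuousAt_fst.eventually (isOpen_Ioo.mem_nhds ht)
  filter_upwards [h4] with p hp
  refine (dist_triangle _ (Φ p.1 x) _).trans ?_
  gcongr
  exact hΦ.dist_le hK _ _ ⟨hp.1.le, hp.2⟩

/-- The variational solution is the strict derivative of the flow in the initial point, uniformly
in time. The curve `Φ τ z' + A τ (z - z')` solves the equation up to an error of second order, so
that Grönwall's inequality bounds its distance from `Φ τ z`. -/
lemma IsLocalFlow.exists_norm_sub_sub_le (hΦ : IsLocalFlow X ε Φ) (hX : Differentiable ℝ X)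
    {K K₂ : NNReal} (hK : LipschitzWith K X) (hK₂ : LipschitzWith K₂ (fderiv ℝ X)) (x : E)
    {A : ℝ → E →L[ℝ] E} (hA : IsVariationalSolution X ε (fun τ => Φ τ x) A) {b : ℝ}
    (hb : b < ε) :
    ∃ C : ℝ, 0 ≤ C ∧ ∀ t ∈ Icc 0 b, ∀ z z' : E,
      ‖Φ t z - Φ t z' - A t (z - z')‖ ≤ C * (‖z' - x‖ + ‖z - z'‖) * ‖z - z'‖ := by
  rcases lt_or_ge b 0 with hb0 | hb0
  · exact ⟨0, le_rfl, fun t ht => absurd (ht.1.trans ht.2) hb0.not_ge⟩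
  have hsub : Icc 0 b ⊆ Ioo (-ε) ε := fun τ hτ =>
    ⟨by linarith [hτ.1], by linarith [hτ.2]⟩
  have hAc : ContinuousOn A (Icc 0 b) := fun τ hτ =>
    (hA.hasDerivAt τ (hsub hτ)).continuousAt.continuousWithinAt
  obtain ⟨a, ha⟩ := isCompact_Icc.exists_bound_of_continuousOn hAc
  have ha0 : 0 ≤ a := (norm_nonneg _).trans (ha 0 ⟨le_rfl, hb0⟩)
  set e := Real.exp (K * ε) with he
  have he0 : 0 < e := Real.exp_pos _
  set K' : NNReal := K + 1 with hK'
  have hK'0 : (0 : ℝ) < K' := by positivity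
  set G := (Real.exp (K' * b) - 1) / K' with hG
  have hG0 : 0 ≤ G := by
    refine div_nonneg ?_ hK'0.le
    linarith [Real.one_le_exp (by positivity : (0 : ℝ) ≤ K' * b)]
  refine ⟨G * (K₂ * (e + a) * a), by positivity, fun t ht z z' => ?_⟩
  set err := K₂ * (e + a) * a * (‖z' - x‖ + ‖z - z'‖) * ‖z - z'‖ with herr
  have hbound : ∀ τ ∈ Icc 0 b,
      ‖X (Φ τ z') + fderiv ℝ X (Φ τ x) (A τ (z - z')) - X (Φ τ z' + A τ (z - z'))‖ ≤ err := by
    intro τ hτ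
    have h1 := norm_sub_sub_fderiv_le hX hK₂ (Φ τ z') (Φ τ x) (A τ (z - z'))
    have h2 : ‖A τ (z - z')‖ ≤ a * ‖z - z'‖ := (A τ).le_of_opNorm_le (ha τ hτ) _
    have h3 : ‖Φ τ z' - Φ τ x‖ ≤ e * ‖z' - x‖ := by
      simpa [dist_eq_norm] using hΦ.dist_le hK z' x ⟨hτ.1, hτ.2.trans_lt hb⟩
    rw [← norm_neg]
    calc _ = ‖X (Φ τ z' + A τ (z - z')) - X (Φ τ z')
            - fderiv ℝ X (Φ τ x) (A τ (z - z'))‖ := by congr 1; abel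
      _ ≤ K₂ * (e * ‖z' - x‖ + a * ‖z - z'‖) * (a * ‖z - z'‖) := h1.trans (by gcongr)
      _ ≤ K₂ * ((e + a) * ‖z' - x‖ + (e + a) * ‖z - z'‖) * (a * ‖z - z'‖) := by
          gcongr
          · exact le_add_of_nonneg_right ha0
          · exact le_add_of_nonneg_left he0.le
      _ = err := by rw [herr]; ring
  have hgd : ∀ τ ∈ Icc 0 b, HasDerivAt (fun τ => Φ τ z' + A τ (z - z'))
      (X (Φ τ z') + fderiv ℝ X (Φ τ x) (A τ (z - z'))) τ := by
    intro τ hτ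
    have h1 := (hA.hasDerivAt τ (hsub hτ)).clm_apply (hasDerivAt_const τ (z - z'))
    simpa using (hΦ.hasDerivAt z' τ (hsub hτ)).fun_add h1
  have key := dist_le_of_approx_trajectories_ODE (v := fun _ => X) (K := K') (a := 0) (b := b)
    (f := fun τ => Φ τ z) (g := fun τ => Φ τ z' + A τ (z - z')) (δ := 0) (εf := 0) (εg := err)
    (fun _ => hK.weaken (by simp [hK'])) ((hΦ.continuousOn z).mono hsub)
    (fun τ hτ => (hΦ.hasDerivAt z τ (hsub (Ico_subset_Icc_self hτ))).hasDerivWithinAt)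
    (by simp) (fun τ hτ => (hgd τ hτ).continuousAt.continuousWithinAt)
    (fun τ hτ => (hgd τ (Ico_subset_Icc_self hτ)).hasDerivWithinAt)
    (fun τ hτ => by rw [dist_eq_norm]; exact hbound τ (Ico_subset_Icc_self hτ))
    (by simp [hΦ.zero, hA.zero]) t ht
  rw [gronwallBound_of_K_ne_0 hK'0.ne', dist_eq_norm] at key
  have herr0 : 0 ≤ err := by positivity
  calc ‖Φ t z - Φ t z' - A t (z - z')‖ = ‖Φ t z - (Φ t z' + A t (z - z'))‖ := by
        congr 1; abel
    _ ≤ err / K' * (Real.exp (K' * t) - 1) := by simpa using key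
    _ ≤ err / K' * (Real.exp (K' * b) - 1) := by gcongr; exact ht.2
    _ = _ := by rw [herr, hG]; ring

/-- The flow is strictly differentiable jointly in time and initial point. -/
lemma IsLocalFlow.hasStrictFDerivAt (hΦ : IsLocalFlow X ε Φ) (hX : Differentiable ℝ X)
    {K K₂ : NNReal} (hK : LipschitzWith K X) (hK₂ : LipschitzWith K₂ (fderiv ℝ X)) (x : E)
    {A : ℝ → E →L[ℝ] E} (hA : IsVariationalSolution X ε (fun τ => Φ τ x) A) {t : ℝ}
    (ht : t ∈ Ioo 0 ε) :
    HasStrictFDerivAt (fun p : ℝ × E => Φ p.1 p.2)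
      ((ContinuousLinearMap.toSpanSingleton ℝ (X (Φ t x))).coprod (A t)) (t, x) := by
  rw [hasStrictFDerivAt_iff_isLittleO]
  obtain ⟨b, htb, hbε⟩ := exists_between ht.2
  obtain ⟨C, hC0, hC⟩ := hΦ.exists_norm_sub_sub_le hX hK hK₂ x hA hbε
  -- the increment in time, at a fixed initial point
  have h1 : (fun χ : (ℝ × E) × (ℝ × E) => Φ χ.1.1 χ.2.2 - Φ χ.2.1 χ.2.2 -
      ContinuousLinearMap.toSpanSingleton ℝ (X (Φ t x)) (χ.1.1 - χ.2.1))
      =o[𝓝 ((t, x), (t, x))] fun χ => χ.1.1 - χ.2.1 := by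
    rw [Asymptotics.isLittleO_iff]
    intro c hc
    have hΦc := hΦ.continuousAt_uncurry hK x ht
    have h2 : ∀ᶠ p : ℝ × E in 𝓝 (t, x), ‖X (Φ p.1 p.2) - X (Φ t x)‖ < c := by
      have h3 : ContinuousAt (fun p : ℝ × E => ‖X (Φ p.1 p.2) - X (Φ t x)‖) (t, x) :=
        ((ContinuousAt.comp' (g := X) hK.continuous.continuousAt hΦc).sub continuousAt_const).norm
      exact h3.eventually_lt continuousAt_const (by simpa using hc)
    obtain ⟨δ, hδ, hball⟩ := Metric.eventually_nhds_iff_ball.1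
      (h2.and (continuousAt_fst.eventually (isOpen_Ioo.mem_nhds ht)))
    filter_upwards [Metric.ball_mem_nhds _ hδ] with χ hχ
    have hmem : ∀ τ ∈ Metric.ball t δ, (τ, χ.2.2) ∈ Metric.ball (t, x) δ := by
      intro τ hτ
      rw [← ball_prod_same, ← ball_prod_same] at hχ
      rw [← ball_prod_same]
      exact ⟨hτ, hχ.2.2⟩
    have hχ1 : χ.1.1 ∈ Metric.ball t δ ∧ χ.2.1 ∈ Metric.ball t δ := by
      rw [← ball_prod_same, ← ball_prod_same] at hχ
      exact ⟨hχ.1.1, hχ.2.1⟩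
    have h4 := Convex.norm_image_sub_le_of_norm_hasDerivWithin_le (𝕜 := ℝ)
      (f := fun τ => Φ τ χ.2.2 - τ • X (Φ t x)) (f' := fun τ => X (Φ τ χ.2.2) - X (Φ t x))
      (s := Metric.ball t δ) (C := c) (x := χ.2.1) (y := χ.1.1)
      (fun τ hτ => by
        have h5 := (hball _ (hmem τ hτ)).2
        simpa using ((hΦ.hasDerivAt χ.2.2 τ ⟨by linarith [h5.1, ht.1, ht.2], h5.2⟩).fun_sub
          ((hasDerivAt_id' τ).smul_const (X (Φ t x)))).hasDerivWithinAt)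
      (fun τ hτ => (hball _ (hmem τ hτ)).1.le) (convex_ball _ _) hχ1.2 hχ1.1
    convert h4 using 2
    rw [ContinuousLinearMap.toSpanSingleton_apply, sub_smul]
    abel
  -- the increment in the initial point, at a fixed time
  have h2 : (fun χ : (ℝ × E) × (ℝ × E) => Φ χ.1.1 χ.1.2 - Φ χ.1.1 χ.2.2 -
      A t (χ.1.2 - χ.2.2)) =o[𝓝 ((t, x), (t, x))] fun χ => χ.1.2 - χ.2.2 := by
    rw [Asymptotics.isLittleO_iff]
    intro c hc
    have hcont : ContinuousAt (fun χ : (ℝ × E) × (ℝ × E) =>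
        C * (‖χ.2.2 - x‖ + ‖χ.1.2 - χ.2.2‖) + ‖A χ.1.1 - A t‖) ((t, x), (t, x)) := by
      have hAt : ContinuousAt (fun χ : (ℝ × E) × (ℝ × E) => A χ.1.1) ((t, x), (t, x)) :=
        ContinuousAt.comp' (f := fun χ : (ℝ × E) × (ℝ × E) => χ.1.1) (g := A)
          (hA.hasDerivAt t ⟨by linarith [ht.1, ht.2], ht.2⟩).continuousAt (by fun_prop)
      exact ContinuousAt.add (by fun_prop) (hAt.sub continuousAt_const).norm
    have hsmall := hcont.eventually_lt (continuousAt_const (y := c)) (by simpa using hc)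
    have htime : ∀ᶠ χ : (ℝ × E) × (ℝ × E) in 𝓝 ((t, x), (t, x)), χ.1.1 ∈ Ioo 0 b :=
      (continuous_fst.comp continuous_fst).continuousAt.eventually
        (isOpen_Ioo.mem_nhds ⟨ht.1, htb⟩)
    filter_upwards [hsmall, htime] with χ h3 h4
    calc _ = ‖(Φ χ.1.1 χ.1.2 - Φ χ.1.1 χ.2.2 - A χ.1.1 (χ.1.2 - χ.2.2)) +
            (A χ.1.1 - A t) (χ.1.2 - χ.2.2)‖ := by
            congr 1; rw [sub_apply]; abel
      _ ≤ C * (‖χ.2.2 - x‖ + ‖χ.1.2 - χ.2.2‖) * ‖χ.1.2 - χ.2.2‖ +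
            ‖A χ.1.1 - A t‖ * ‖χ.1.2 - χ.2.2‖ :=
          (norm_add_le _ _).trans (add_le_add (hC _ (Ioo_subset_Icc_self h4) _ _)
            (ContinuousLinearMap.le_opNorm _ _))
      _ ≤ c * ‖χ.1.2 - χ.2.2‖ := by
          rw [← add_mul]
          gcongr
  have h3 : (fun χ : (ℝ × E) × (ℝ × E) => χ.1.1 - χ.2.1) =O[𝓝 ((t, x), (t, x))]
      fun χ => χ.1 - χ.2 :=
    Asymptotics.isBigO_of_le _ fun χ => norm_fst_le (χ.1 - χ.2)
  have h4 : (fun χ : (ℝ × E) × (ℝ × E) => χ.1.2 - χ.2.2) =O[𝓝 ((t, x), (t, x))]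
      fun χ => χ.1 - χ.2 :=
    Asymptotics.isBigO_of_le _ fun χ => norm_snd_le (χ.1 - χ.2)
  refine ((h1.trans_isBigO h3).add (h2.trans_isBigO h4)).congr_left fun χ => ?_
  simp only [ContinuousLinearMap.coprod_apply, Prod.fst_sub, Prod.snd_sub]
  abel

/-- A smooth compactly supported vector field has, for short times, a flow together with its
derivatives in the initial point. -/
theorem exists_isLocalFlow_isVariationalSolution [CompleteSpace E] (hX : ContDiff ℝ ∞ X)
    (hc : HasCompactSupport X) : ∃ ε Φ, ∃ A : E → ℝ → E →L[ℝ] E,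
      IsLocalFlow X ε Φ ∧ (∀ x, IsVariationalSolution X ε (fun τ => Φ τ x) (A x)) ∧
      ∀ x, ∀ t ∈ Ioo 0 ε, HasStrictFDerivAt (fun p : ℝ × E => Φ p.1 p.2)
        ((ContinuousLinearMap.toSpanSingleton ℝ (X (Φ t x))).coprod (A x t)) (t, x) := by
  obtain ⟨K, hK⟩ := ContDiff.lipschitzWith_of_hasCompactSupport (𝕂 := ℝ) hc hX (by simp)
  obtain ⟨K₂, hK₂⟩ := ContDiff.lipschitzWith_of_hasCompactSupport (𝕂 := ℝ) (hc.fderiv ℝ)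
    (hX.fderiv_right (m := ∞) (by simp)) (by simp)
  obtain ⟨L, hL⟩ := hX.continuous.bounded_above_of_compact_support hc
  have hε : (0 : ℝ) < 1 / (2 * K + 1) := by positivity
  set ε : ℝ := 1 / (2 * K + 1) with hεdef
  have hKε : 2 * K * ε ≤ 1 := by
    rw [hεdef, mul_one_div, div_le_one (by positivity)]
    linarith
  obtain ⟨Φ, hΦ'⟩ := exists_isLocalFlow hK hL (by positivity : 0 < 2 * ε)
  have hΦ : IsLocalFlow X ε Φ :=
    ⟨hε, hΦ'.zero, fun x t ht => hΦ'.hasDerivAt x t ⟨by linarith [ht.1], by linarith [ht.2]⟩⟩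
  have hA := fun x => exists_isVariationalSolution (hX.of_le (by exact_mod_cast le_top)) hK hε hKε
    (by linarith : ε < 2 * ε) (hΦ'.continuousOn x)
  choose A hA using hA
  exact ⟨ε, Φ, A, hΦ, hA, fun x t ht =>
    hΦ.hasStrictFDerivAt (hX.differentiable (by simp)) hK hK₂ x (hA x) ht⟩

end Flow

/-! ### Orbits of bracket generating families on a vector space -/

section Krener

variable {E : Type*} [NormedAddCommGroup E] [NormedSpace ℝ E]

/-- A curve solving `ċ = X c` with `‖X‖ ≤ L` moves with speed at most `L`. -/
lemma IsLocalFlow.norm_sub_le {X : E → E} {ε : ℝ} {Φ : ℝ → E → E} (hΦ : IsLocalFlow X ε Φ)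
    {L : ℝ} (hL : ∀ x, ‖X x‖ ≤ L) (x : E) {t : ℝ} (ht : t ∈ Ico 0 ε) :
    ‖Φ t x - x‖ ≤ L * t := by
  have := Convex.norm_image_sub_le_of_norm_hasDerivWithin_le (𝕜 := ℝ)
    (f := fun τ => Φ τ x) (f' := fun τ => X (Φ τ x)) (s := Ico 0 ε) (x := 0) (y := t) (C := L)
    (fun τ hτ => (hΦ.hasDerivAt x τ ⟨by linarith [hτ.1, hΦ.pos], hτ.2⟩).hasDerivWithinAt)
    (fun τ _ => hL _) (convex_Ico _ _) ⟨le_rfl, hΦ.pos⟩ ht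
  simpa [hΦ.zero, abs_of_nonneg ht.1] using this

/-- The iterated Lie brackets `[G_{j₁}, [G_{j₂}, … G_{j_k}]]` of a family of vector fields on a
vector space. -/
inductive IsLieIterate {ι : Type*} (G : ι → E → E) : (E → E) → Prop
  | base (j : ι) : IsLieIterate G (G j)
  | bracket (j : ι) (Z : E → E) (hZ : IsLieIterate G Z) :
      IsLieIterate G (VectorField.lieBracket ℝ (G j) Z)

lemma IsLieIterate.contDiff {ι : Type*} {G : ι → E → E} (hG : ∀ j, ContDiff ℝ ∞ (G j))
    {Z : E → E} (hZ : IsLieIterate G Z) : ContDiff ℝ ∞ Z := by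
  induction hZ with
  | base j => exact hG j
  | bracket j Z _ ih =>
    exact ((ih.fderiv_right (m := ∞) (by simp)).clm_apply (hG j)).sub
      (((hG j).fderiv_right (m := ∞) (by simp)).clm_apply ih)

/-- The set `O` is saturated in `B` for the fields `G j`: an integral curve of one of the fields
which stays in `B` starts in `O` if and only if it ends in `O`. -/
def IsSaturated {ι : Type*} (G : ι → E → E) (B O : Set E) : Prop :=
  ∀ j, ∀ c : ℝ → E, ∀ t : ℝ, 0 < t → (∀ τ ∈ Icc 0 t, HasDerivAt c (G j (c τ)) τ) →
    (∀ τ ∈ Icc 0 t, c τ ∈ B) → (c 0 ∈ O ↔ c t ∈ O)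

/-- `W` is a tangent space at `y ∈ B` to `O`, in the sense that it is the range of the strict
derivative of a map into `O` from a Banach space. It is also recorded that `O` is a neighbourhood
of the base point `x₀` as soon as it is one of `y`. -/
structure IsTangentAt (B O : Set E) (x₀ y : E) (W : Submodule ℝ E) : Prop where
  mem : y ∈ B
  mem_nhds : O ∈ 𝓝 y → O ∈ 𝓝 x₀
  exists_map : ∃ (P : Type) (_ : NormedAddCommGroup P) (_ : NormedSpace ℝ P)
    (_ : CompleteSpace P) (F : P → E) (F' : P →L[ℝ] E), F 0 = y ∧ HasStrictFDerivAt F F' 0 ∧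
      F'.range = W ∧ ∀ᶠ p in 𝓝 0, F p ∈ O

variable {ι : Type*} {G : ι → E → E} {B O : Set E} {x₀ : E}

lemma isTangentAt_bot (hx₀ : x₀ ∈ B) (hO : x₀ ∈ O) : IsTangentAt B O x₀ x₀ ⊥ :=
  ⟨hx₀, id, ℝ, inferInstance, inferInstance, inferInstance, fun _ => x₀, 0, rfl,
    hasStrictFDerivAt_const _ _, by
      ext v
      simp, .of_forall fun _ => hO⟩

/-- A tangent space is moved by the flow of a field, and the field may then be added to it: time
is an additional parameter. -/
lemma IsTangentAt.exists_flow [CompleteSpace E] (hB : IsOpen B) (hO : IsSaturated G B O) (j : ι)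
    {L : ℝ} (hL : ∀ x, ‖G j x‖ ≤ L) {ε : ℝ} {Φ : ℝ → E → E} (hΦ : IsLocalFlow (G j) ε Φ)
    {y : E} {W : Submodule ℝ E} {A : ℝ → E →L[ℝ] E}
    (hA : ∀ t ∈ Ioo 0 ε, HasStrictFDerivAt (fun p : ℝ × E => Φ p.1 p.2)
        ((ContinuousLinearMap.toSpanSingleton ℝ (G j (Φ t y))).coprod (A t)) (t, y))
    (h : IsTangentAt B O x₀ y W) :
    ∃ η > 0, ∀ τ ∈ Ioo 0 η,
      IsTangentAt B O x₀ (Φ τ y) (W.map (A τ).toLinearMap ⊔ Submodule.span ℝ {G j (Φ τ y)}) := by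
  obtain ⟨r, hr, hrB⟩ := Metric.isOpen_iff.1 hB y h.mem
  have hL0 : 0 ≤ L := (norm_nonneg _).trans (hL y)
  -- up to time `η` the curves from the ball of radius `r / 2` stay in the ball of radius `r`
  set η := min ε (r / 2 / (L + 1)) with hη
  have hη0 : 0 < η := lt_min hΦ.pos (by positivity)
  have hstay : ∀ z ∈ Metric.ball y (r / 2), ∀ t ∈ Ico 0 η, Φ t z ∈ B := by
    intro z hz t ht
    refine hrB ?_
    have h1 := hΦ.norm_sub_le hL z ⟨ht.1, ht.2.trans_le (min_le_left _ _)⟩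
    have h2 : (L + 1) * t < r / 2 := by
      have := ht.2.trans_le (min_le_right _ _)
      rwa [lt_div_iff₀ (by positivity), mul_comm] at this
    have h3 : L * t ≤ (L + 1) * t := by nlinarith [ht.1]
    rw [← dist_eq_norm] at h1
    rw [Metric.mem_ball] at hz ⊢
    linarith [dist_triangle (Φ t z) z y]
  have hiff : ∀ z ∈ Metric.ball y (r / 2), ∀ t ∈ Ioo 0 η, (z ∈ O ↔ Φ t z ∈ O) := by
    intro z hz t ht
    have := hO j (fun τ => Φ τ z) t ht.1
      (fun τ hτ => hΦ.hasDerivAt z τ ⟨by linarith [hτ.1, hΦ.pos],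
        (hτ.2.trans_lt ht.2).trans_le (min_le_left _ _)⟩)
      (fun τ hτ => hstay z hz τ ⟨hτ.1, hτ.2.trans_lt ht.2⟩)
    simpa [hΦ.zero] using this
  refine ⟨η, hη0, fun τ hτ => ?_⟩
  have hτε : τ ∈ Ioo 0 ε := ⟨hτ.1, hτ.2.trans_le (min_le_left _ _)⟩
  have hball : Metric.ball y (r / 2) ∈ 𝓝 y := Metric.ball_mem_nhds _ (by positivity)
  refine ⟨hstay y (mem_of_mem_nhds hball) τ (Ioo_subset_Ico_self hτ), fun hOτ => ?_, ?_⟩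
  · refine h.mem_nhds ?_
    have hcont : ContinuousAt (fun z => Φ τ z) y :=
      ContinuousAt.comp' (f := fun z => (τ, z)) (g := fun p : ℝ × E => Φ p.1 p.2)
        (hA τ hτε).continuousAt (by fun_prop)
    filter_upwards [hcont.eventually hOτ, hball] with z hz hzb
    exact (hiff z hzb τ hτ).2 hz
  · obtain ⟨P, _, _, _, F, F', hF0, hF, hrange, hFO⟩ := h.exists_map
    have hsh : HasStrictFDerivAt (fun q : ℝ × P => (τ + q.1, F q.2))
        ((ContinuousLinearMap.fst ℝ ℝ P).prod (F'.comp (ContinuousLinearMap.snd ℝ ℝ P)))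
        (0, 0) :=
      ((ContinuousLinearMap.fst ℝ ℝ P).hasStrictFDerivAt.const_add τ).prodMk
        (HasStrictFDerivAt.comp (g := F) (f := Prod.snd) (0, 0) hF hasStrictFDerivAt_snd)
    have hcomp := HasStrictFDerivAt.comp (g := fun p : ℝ × E => Φ p.1 p.2)
      (f := fun q : ℝ × P => (τ + q.1, F q.2)) (0, 0) (by simpa [hF0] using hA τ hτε) hsh
    refine ⟨ℝ × P, inferInstance, inferInstance, inferInstance,
      fun q => Φ (τ + q.1) (F q.2), _, by simp [hF0], hcomp, ?_, ?_⟩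
    · ext v
      rw [sup_comm, Submodule.mem_sup]
      simp only [← hrange, Submodule.mem_span_singleton, Submodule.mem_map,
        LinearMap.mem_range]
      constructor
      · rintro ⟨⟨a, p⟩, rfl⟩
        exact ⟨_, ⟨a, rfl⟩, _, ⟨_, ⟨p, rfl⟩, rfl⟩, by simp⟩
      · rintro ⟨_, ⟨a, rfl⟩, _, ⟨_, ⟨p, rfl⟩, rfl⟩, rfl⟩
        exact ⟨(a, p), by simp⟩
    · have h1 : ∀ᶠ q : ℝ × P in 𝓝 0, τ + q.1 ∈ Ioo 0 η := by
        have : ContinuousAt (fun q : ℝ × P => τ + q.1) 0 := by fun_prop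
        exact this.eventually (isOpen_Ioo.mem_nhds (by simpa using hτ))
      have hsnd : Filter.Tendsto (Prod.snd : ℝ × P → P) (𝓝 0) (𝓝 0) :=
        continuous_snd.tendsto' _ _ rfl
      have h2 : ∀ᶠ q : ℝ × P in 𝓝 0, F q.2 ∈ Metric.ball y (r / 2) :=
        hsnd.eventually (hF.continuousAt.eventually (by rwa [hF0]))
      filter_upwards [h1, h2, hsnd.eventually hFO] with q hq1 hq2 hq3
      exact (hiff _ hq2 _ hq1).1 hq3

/-- Pulling a field `Z` back by the flow of `X` gives a curve in the tangent space at `y` with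
value `Z y` and derivative `[X, Z] y` at time `0`. Hence a subspace containing the curve contains
both. -/
lemma mem_and_lieBracket_mem_of_forall_mem_map [FiniteDimensional ℝ E] {X Z : E → E}
    {ε : ℝ} {Φ : ℝ → E → E} (hΦ : IsLocalFlow X ε Φ) {y : E} (hZ : DifferentiableAt ℝ Z y)
    {A : ℝ → E →L[ℝ] E} (hA : IsVariationalSolution X ε (fun τ => Φ τ y) A)
    {W : Submodule ℝ E} {η : ℝ} (hη : 0 < η)
    (hW : ∀ τ ∈ Ioo 0 η, Z (Φ τ y) ∈ W.map (A τ).toLinearMap) :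
    Z y ∈ W ∧ VectorField.lieBracket ℝ X Z y ∈ W := by
  have h0 : (0 : ℝ) ∈ Ioo (-ε) ε := ⟨by linarith [hΦ.pos], hΦ.pos⟩
  have hA0 : A 0 = ((1 : (E →L[ℝ] E)ˣ) : E →L[ℝ] E) := hA.zero
  have hAd : HasDerivAt A (fderiv ℝ X y) 0 := by
    have := hA.hasDerivAt 0 h0
    rw [hA.zero, ContinuousLinearMap.comp_id] at this
    simpa [hΦ.zero] using this
  have hinv : HasDerivAt (fun τ => Ring.inverse (A τ)) (-(fderiv ℝ X y)) 0 := by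
    have h1 : HasFDerivAt Ring.inverse _ (A 0) :=
      hA0 ▸ hasFDerivAt_ringInverse (𝕜 := ℝ) (1 : (E →L[ℝ] E)ˣ)
    simpa [hA.zero, ← ContinuousLinearMap.one_def] using! h1.comp_hasDerivAt 0 hAd
  have hZd : HasDerivAt (fun τ => Z (Φ τ y)) (fderiv ℝ Z y (X y)) 0 := by
    have h1 : HasFDerivAt Z (fderiv ℝ Z y) (Φ 0 y) := by rw [hΦ.zero]; exact hZ.hasFDerivAt
    have h2 := hΦ.hasDerivAt y 0 h0
    rw [hΦ.zero] at h2
    exact h1.comp_hasDerivAt 0 h2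
  have hw := hinv.clm_apply hZd
  have hval : (-(fderiv ℝ X y)) (Z (Φ 0 y)) + Ring.inverse (A 0) (fderiv ℝ Z y (X y)) =
      VectorField.lieBracket ℝ X Z y := by
    rw [hA0, hΦ.zero, Ring.inverse_unit, VectorField.lieBracket]
    simp [sub_eq_add_neg, add_comm]
  rw [hval] at hw
  have hunit : ∀ᶠ τ in 𝓝[>] (0 : ℝ), IsUnit (A τ) :=
    (hAd.continuousAt.eventually
      (Units.isOpen.mem_nhds (hA0 ▸ (1 : (E →L[ℝ] E)ˣ).isUnit))).filter_mono nhdsWithin_le_nhds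
  have hmem : ∀ᶠ τ in 𝓝[>] (0 : ℝ), Ring.inverse (A τ) (Z (Φ τ y)) ∈ W := by
    filter_upwards [hunit, Ioo_mem_nhdsGT hη] with τ hτ hτη
    obtain ⟨w, hw, hwZ⟩ := hW τ hτη
    have h2 : Ring.inverse (A τ) (A τ w) = w := by
      rw [← mul_apply_eq_comp, Ring.inverse_mul_cancel _ hτ]
      simp
    rw [← hwZ]
    simpa [h2] using hw
  have hval0 : Ring.inverse (A 0) (Z (Φ 0 y)) = Z y := by
    rw [hA0, Ring.inverse_unit, hΦ.zero]
    simp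
  have hy : Z y ∈ W := by
    refine W.closed_of_finiteDimensional.mem_of_tendsto ?_ hmem
    have := hw.continuousAt.tendsto
    rw [hval0] at this
    exact this.mono_left nhdsWithin_le_nhds
  refine ⟨hy, W.closed_of_finiteDimensional.mem_of_tendsto hw.tendsto_slope_zero_right ?_⟩
  filter_upwards [hmem] with τ hτ
  refine W.smul_mem _ (W.sub_mem ?_ ?_)
  · simpa using hτ
  · rwa [hval0]

/-- The orbit theorem for bracket generating families: a saturated set is a neighbourhood of each
of its points. At a tangent space of maximal dimension no field can be added, also after moving it
by the flows, so that it contains all iterated brackets. -/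
theorem mem_nhds_of_isSaturated [FiniteDimensional ℝ E] (hG : ∀ j, ContDiff ℝ ∞ (G j))
    (hc : ∀ j, HasCompactSupport (G j)) (hB : IsOpen B)
    (hspan : ∀ y ∈ B, Submodule.span ℝ {v | ∃ Z, IsLieIterate G Z ∧ v = Z y} = ⊤)
    (hO : IsSaturated G B O) (hx₀B : x₀ ∈ B) (hx₀ : x₀ ∈ O) : O ∈ 𝓝 x₀ := by
  have : CompleteSpace E := FiniteDimensional.complete ℝ E
  choose ε Φ A hΦ hA hstrict using
    fun j => exists_isLocalFlow_isVariationalSolution (hG j) (hc j)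
  have hbdd := fun j => (hG j).continuous.bounded_above_of_compact_support (hc j)
  choose L hL using hbdd
  let dims : Set ℕ := {k | ∃ y W, IsTangentAt B O x₀ y W ∧ Module.finrank ℝ W = k}
  have hdims : BddAbove dims := ⟨Module.finrank ℝ E, by
    rintro _ ⟨y, W, _, rfl⟩
    exact W.finrank_le⟩
  obtain ⟨y, W, hyW, hdim⟩ : sSup dims ∈ dims :=
    Nat.sSup_mem ⟨_, x₀, ⊥, isTangentAt_bot hx₀B hx₀, rfl⟩ hdims
  have hmax : ∀ y W, IsTangentAt B O x₀ y W → Module.finrank ℝ W ≤ sSup dims :=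
    fun y W h => le_csSup hdims ⟨y, W, h, rfl⟩
  -- tangent spaces of maximal dimension are moved by the flows, and contain the fields
  have hmove : ∀ j y W, IsTangentAt B O x₀ y W → Module.finrank ℝ W = sSup dims →
      ∃ η > 0, ∀ τ ∈ Ioo 0 η,
        G j (Φ j τ y) ∈ W.map (A j y τ).toLinearMap ∧
        IsTangentAt B O x₀ (Φ j τ y) (W.map (A j y τ).toLinearMap) ∧
        Module.finrank ℝ (W.map (A j y τ).toLinearMap) = sSup dims := by
    intro j y W h hW
    obtain ⟨η, hη, hstep⟩ := h.exists_flow hB hO j (hL j) (hΦ j) (hstrict j y)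
    have hAc : ContinuousAt (A j y) 0 :=
      ((hA j y).hasDerivAt 0 ⟨by linarith [(hΦ j).pos], (hΦ j).pos⟩).continuousAt
    have hunit : ∀ᶠ τ in 𝓝 (0 : ℝ), IsUnit (A j y τ) :=
      hAc.eventually (Units.isOpen.mem_nhds (by rw [(hA j y).zero]; exact isUnit_one))
    obtain ⟨δ, hδ, hball⟩ := Metric.eventually_nhds_iff_ball.1 hunit
    refine ⟨min η δ, lt_min hη hδ, fun τ hτ => ?_⟩
    have hs := hstep τ ⟨hτ.1, hτ.2.trans_le (min_le_left _ _)⟩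
    have hu : IsUnit (A j y τ) := hball τ (by
      simpa [abs_of_pos hτ.1] using hτ.2.trans_le (min_le_right _ _))
    have hinj : Function.Injective (A j y τ).toLinearMap := by
      intro v w hvw
      have h1 : Ring.inverse (A j y τ) (A j y τ v) = Ring.inverse (A j y τ) (A j y τ w) :=
        congrArg _ hvw
      simpa [← mul_apply_eq_comp, Ring.inverse_mul_cancel _ hu] using h1
    have hfr : Module.finrank ℝ (W.map (A j y τ).toLinearMap) = sSup dims := by
      rw [← hW]
      exact (Submodule.equivMapOfInjective _ hinj W).finrank_eq.symm
    have heq : W.map (A j y τ).toLinearMap =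
        W.map (A j y τ).toLinearMap ⊔ Submodule.span ℝ {G j (Φ j τ y)} :=
      Submodule.eq_of_le_of_finrank_le le_sup_left (by rw [hfr]; exact hmax _ _ hs)
    refine ⟨?_, heq ▸ hs, hfr⟩
    rw [heq]
    exact Submodule.mem_sup_right (Submodule.mem_span_singleton_self _)
  have hfields : ∀ Z, IsLieIterate G Z → ∀ y W, IsTangentAt B O x₀ y W →
      Module.finrank ℝ W = sSup dims → Z y ∈ W := by
    intro Z hZ
    induction hZ with
    | base j =>
      intro y W h hW
      obtain ⟨η, hη, hmv⟩ := hmove j y W h hW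
      exact (mem_and_lieBracket_mem_of_forall_mem_map (hΦ j)
        ((hG j).differentiable (by simp) y) (hA j y) hη fun τ hτ => (hmv τ hτ).1).1
    | bracket j Z hZ ih =>
      intro y W h hW
      obtain ⟨η, hη, hmv⟩ := hmove j y W h hW
      exact (mem_and_lieBracket_mem_of_forall_mem_map (hΦ j)
        ((hZ.contDiff hG).differentiable (by simp) y) (hA j y) hη
        fun τ hτ => ih _ _ (hmv τ hτ).2.1 (hmv τ hτ).2.2).2
  have hWtop : W = ⊤ := by
    rw [eq_top_iff, ← hspan y hyW.mem, Submodule.span_le]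
    rintro _ ⟨Z, hZ, rfl⟩
    exact hfields Z hZ y W hyW hdim
  obtain ⟨P, _, _, _, F, F', hF0, hF, hrange, hFO⟩ := hyW.exists_map
  refine hyW.mem_nhds ?_
  rw [← hF0, ← hF.map_nhds_eq_of_surj (hrange.trans hWtop)]
  exact hFO

end Krener

/-! ### Vector fields and curves in charts -/

lemma two_le_infty : (2 : ℕ∞ω) ≤ ∞ := WithTop.coe_le_coe.2 le_top

section Chart

variable {n : ℕ} {M : Type*} [TopologicalSpace M] [ChartedSpace (EuclideanSpace ℝ (Fin n)) M]

/-- The curve `x` has velocity `v` at time `t`. -/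
abbrev HasVelocityAt (x : ℝ → M) (t : ℝ) (v : TangentSpace (𝓡 n) (x t)) : Prop :=
  HasMFDerivAt 𝓘(ℝ, ℝ) (𝓡 n) x t ((1 : ℝ →L[ℝ] ℝ).smulRight v)

/-- The representation of a vector field in the chart at `p`. -/
noncomputable def chartField (p : M) (X : VField n M) :
    EuclideanSpace ℝ (Fin n) → EuclideanSpace ℝ (Fin n) :=
  VectorField.mpullback 𝓘(ℝ, EuclideanSpace ℝ (Fin n)) (𝓡 n) (extChartAt (𝓡 n) p).symm X

/-- Affine change of the time variable. -/
lemma HasVelocityAt.comp_affine {x : ℝ → M} {a b t : ℝ} {v : TangentSpace (𝓡 n) (x (a * t + b))}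
    (hx : HasVelocityAt x (a * t + b) v) : HasVelocityAt (fun τ => x (a * τ + b)) t (a • v) := by
  have h1 : HasDerivAt (fun τ : ℝ => a * τ + b) a t := by
    simpa using ((hasDerivAt_id t).const_mul a).add_const b
  refine (HasMFDerivAt.comp t hx h1.hasFDerivAt.hasMFDerivAt).congr_mfderiv ?_
  refine ContinuousLinearMap.ext_ring ?_
  change ((1 : ℝ) * a) • v = (1 : ℝ) • (a • v)
  rw [one_mul, one_smul]

variable [IsManifold (𝓡 n) ∞ M]

lemma contMDiffAt_extChartAt_symm (p : M) {y : EuclideanSpace ℝ (Fin n)}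
    (hy : y ∈ (extChartAt (𝓡 n) p).target) :
    ContMDiffAt 𝓘(ℝ, EuclideanSpace ℝ (Fin n)) (𝓡 n) ∞ (extChartAt (𝓡 n) p).symm y :=
  (contMDiffOn_extChartAt_symm p).contMDiffAt ((isOpen_extChartAt_target p).mem_nhds hy)

lemma isInvertible_mfderiv_extChartAt_symm (p : M) {y : EuclideanSpace ℝ (Fin n)}
    (hy : y ∈ (extChartAt (𝓡 n) p).target) :
    (mfderiv 𝓘(ℝ, EuclideanSpace ℝ (Fin n)) (𝓡 n) (extChartAt (𝓡 n) p).symm y).IsInvertible := by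
  have : IsManifold (𝓡 n) 1 M := .of_le (n := ∞) (by simp)
  have h := isInvertible_mfderivWithin_extChartAt_symm (I := 𝓡 n) hy
  rwa [ModelWithCorners.range_eq_univ, mfderivWithin_univ] at h

lemma IsSmooth.contDiffOn_chartField {X : VField n M} (hX : IsSmooth X) (p : M) :
    ContDiffOn ℝ ∞ (chartField p X) (extChartAt (𝓡 n) p).target := by
  intro y hy
  refine (contMDiffAt_vectorSpace_iff_contDiffAt.1 ?_).contDiffWithinAt
  exact ContMDiffAt.mpullback_vectorField_preimage (n := ∞) (hX _)
    (contMDiffAt_extChartAt_symm p hy) (isInvertible_mfderiv_extChartAt_symm p hy) (by simp)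

lemma IsSmooth.mlieBracket {X Y : VField n M} (hX : IsSmooth X) (hY : IsSmooth Y) :
    IsSmooth (VectorField.mlieBracket (𝓡 n) X Y) := fun x => by
  have : IsManifold (𝓡 n) (((⊤ : ℕ∞) : ℕ∞ω) + 1) M := .of_le (n := ∞) (by simp)
  have : IsManifold (𝓡 n) (minSmoothness ℝ 2) M :=
    .of_le (n := ∞) (by simpa using two_le_infty)
  have := ContMDiffAt.mlieBracket_vectorField (I := 𝓡 n) (m := ⊤) (n := ⊤) (hX x) (hY x) (by simp)
  exact this

lemma chartField_mlieBracket {X Y : VField n M} (hX : IsSmooth X) (hY : IsSmooth Y) (p : M)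
    {y : EuclideanSpace ℝ (Fin n)} (hy : y ∈ (extChartAt (𝓡 n) p).target) :
    chartField p (VectorField.mlieBracket (𝓡 n) X Y) y =
      VectorField.lieBracket ℝ (chartField p X) (chartField p Y) y := by
  have : IsManifold (𝓡 n) (minSmoothness ℝ 2) M :=
    .of_le (n := ∞) (by simpa using two_le_infty)
  have h := VectorField.mpullback_mlieBracket (n := ∞) ((hX _).mdifferentiableAt (by simp))
    ((hY _).mdifferentiableAt (by simp)) (contMDiffAt_extChartAt_symm p hy)
    (by simpa using two_le_infty)
  refine h.trans ?_
  rw [← VectorField.mlieBracketWithin_univ]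
  refine (congrFun VectorField.mlieBracketWithin_eq_lieBracketWithin y).trans ?_
  exact congrFun VectorField.lieBracketWithin_univ y

lemma mfderiv_extChartAt_symm_chartField (X : VField n M) (p : M)
    {y : EuclideanSpace ℝ (Fin n)} (hy : y ∈ (extChartAt (𝓡 n) p).target) :
    mfderiv 𝓘(ℝ, EuclideanSpace ℝ (Fin n)) (𝓡 n) (extChartAt (𝓡 n) p).symm y (chartField p X y) =
      X ((extChartAt (𝓡 n) p).symm y) :=
  (isInvertible_mfderiv_extChartAt_symm p hy).self_apply_inverse _

lemma mfderiv_extChartAt_apply (X : VField n M) (p : M) {q : M}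
    (hq : q ∈ (extChartAt (𝓡 n) p).source) :
    mfderiv (𝓡 n) 𝓘(ℝ, EuclideanSpace ℝ (Fin n)) (extChartAt (𝓡 n) p) q (X q) =
      chartField p X (extChartAt (𝓡 n) p q) := by
  have : IsManifold (𝓡 n) 1 M := .of_le (n := ∞) (by simp)
  obtain ⟨y, hy, rfl⟩ : ∃ y ∈ (extChartAt (𝓡 n) p).target, (extChartAt (𝓡 n) p).symm y = q :=
    ⟨_, (extChartAt (𝓡 n) p).map_source hq, (extChartAt (𝓡 n) p).left_inv hq⟩
  have h := mfderiv_extChartAt_comp_mfderivWithin_extChartAt_symm (I := 𝓡 n) hy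
  rw [ModelWithCorners.range_eq_univ, mfderivWithin_univ] at h
  rw [(extChartAt (𝓡 n) p).right_inv hy, ← mfderiv_extChartAt_symm_chartField X p hy]
  exact congrArg (fun B => B (chartField p X y)) h

variable {s : ℕ}

/-- In a chart, a curve with velocity `∑ j, u j • f j` has velocity
`∑ j, u j • chartField p (f j)`. -/
lemma HasVelocityAt.hasDerivAt_extChartAt {f : Fin s → VField n M} {x : ℝ → M} {t : ℝ}
    {u : Fin s → ℝ} (hx : HasVelocityAt x t (∑ j, u j • f j (x t) : TangentSpace (𝓡 n) (x t)))
    (p : M) (hp : x t ∈ (extChartAt (𝓡 n) p).source) :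
    HasDerivAt (fun τ => extChartAt (𝓡 n) p (x τ))
      (∑ j, u j • chartField p (f j) (extChartAt (𝓡 n) p (x t))) t := by
  have : IsManifold (𝓡 n) 1 M := .of_le (n := ∞) (by simp)
  have h1 : HasMFDerivAt (𝓡 n) 𝓘(ℝ, EuclideanSpace ℝ (Fin n)) (extChartAt (𝓡 n) p) (x t) _ :=
    (mdifferentiableAt_extChartAt (by rwa [extChartAt_source] at hp)).hasMFDerivAt
  have h2 : HasFDerivAt (fun τ => extChartAt (𝓡 n) p (x τ))
      ((mfderiv (𝓡 n) 𝓘(ℝ, EuclideanSpace ℝ (Fin n)) (extChartAt (𝓡 n) p) (x t)).comp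
        ((1 : ℝ →L[ℝ] ℝ).smulRight (∑ j, u j • f j (x t) : TangentSpace (𝓡 n) (x t))) :
          ℝ →L[ℝ] EuclideanSpace ℝ (Fin n)) t :=
    hasMFDerivAt_iff_hasFDerivAt.1 (HasMFDerivAt.comp t h1 hx)
  refine hasDerivAt_iff_hasFDerivAt.2 (h2.congr_fderiv (ContinuousLinearMap.ext_ring ?_))
  refine Eq.trans ?_ (one_smul ℝ
    (∑ j, u j • chartField p (f j) (extChartAt (𝓡 n) p (x t)))).symm
  simp only [← mfderiv_extChartAt_apply _ p hp]
  refine (congrArg (mfderiv (𝓡 n) 𝓘(ℝ, EuclideanSpace ℝ (Fin n)) (extChartAt (𝓡 n) p) (x t))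
    (one_smul ℝ (∑ j, u j • f j (x t) : TangentSpace (𝓡 n) (x t)))).trans ?_
  exact (map_sum _ _ _).trans (Finset.sum_congr rfl fun j _ => ContinuousLinearMap.map_smul _ _ _)

/-- An integral curve in a chart is an integral curve on the manifold. -/
lemma hasVelocityAt_extChartAt_symm {X : VField n M} (p : M) {c : ℝ → EuclideanSpace ℝ (Fin n)}
    {t a : ℝ} (hc : HasDerivAt c (a • chartField p X (c t)) t)
    (ht : c t ∈ (extChartAt (𝓡 n) p).target) :
    HasVelocityAt (fun τ => (extChartAt (𝓡 n) p).symm (c τ)) t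
      (a • X ((extChartAt (𝓡 n) p).symm (c t)) :
        TangentSpace (𝓡 n) ((extChartAt (𝓡 n) p).symm (c t))) := by
  have h1 : HasMFDerivAt 𝓘(ℝ, EuclideanSpace ℝ (Fin n)) (𝓡 n) (extChartAt (𝓡 n) p).symm (c t) _ :=
    ((contMDiffAt_extChartAt_symm p ht).mdifferentiableAt (by simp)).hasMFDerivAt
  have h2 := HasMFDerivAt.comp t h1 hc.hasFDerivAt.hasMFDerivAt
  refine h2.congr_mfderiv ?_
  rw [← mfderiv_extChartAt_symm_chartField X p ht]
  refine ContinuousLinearMap.ext_ring ?_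
  refine (congrArg (mfderiv 𝓘(ℝ, EuclideanSpace ℝ (Fin n)) (𝓡 n) (extChartAt (𝓡 n) p).symm (c t))
    (one_smul ℝ (a • chartField p X (c t)))).trans ?_
  exact (ContinuousLinearMap.map_smul _ _ _).trans (one_smul ℝ _).symm

end Chart

/-! ### Piecewise regular trajectories -/

section Regular

variable {n s : ℕ} {M : Type*} [TopologicalSpace M] [ChartedSpace (EuclideanSpace ℝ (Fin n)) M]

/-- `x` is a continuous solution on `[a, b]` of `ẋ = ∑ j, u j • f j x`, differentiable outside a
countable set. -/
structure IsRegularTrajectory (f : Fin s → VField n M) (a b : ℝ) (u : ℝ → Fin s → ℝ)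
    (x : ℝ → M) : Prop where
  continuousOn : ContinuousOn x (Icc a b)
  exists_countable : ∃ S : Set ℝ, S.Countable ∧ ∀ t ∈ Ioo a b \ S,
    HasVelocityAt x t (∑ j, u t j • f j (x t) : TangentSpace (𝓡 n) (x t))

/-- Measurable and bounded controls. -/
structure IsBoundedControl (u : ℝ → Fin s → ℝ) : Prop where
  measurable : Measurable u
  exists_bound : ∃ C, ∀ t j, |u t j| ≤ C

variable {f : Fin s → VField n M} {u : ℝ → Fin s → ℝ} {x : ℝ → M}

/-- The velocity only depends on the germ of the curve; here the field is evaluated along the new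
curve. -/
lemma HasVelocityAt.congr {t : ℝ} {w : Fin s → ℝ} {y : ℝ → M}
    (hx : HasVelocityAt x t (∑ j, w j • f j (x t) : TangentSpace (𝓡 n) (x t)))
    (hy : y =ᶠ[𝓝 t] x) :
    HasVelocityAt y t (∑ j, w j • f j (y t) : TangentSpace (𝓡 n) (y t)) := by
  have key : ∀ q, q = x t → HasMFDerivAt 𝓘(ℝ, ℝ) (𝓡 n) y t
      ((1 : ℝ →L[ℝ] ℝ).smulRight (∑ j, w j • f j q : TangentSpace (𝓡 n) q)) := by
    rintro _ rfl
    exact hx.congr_of_eventuallyEq hy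
  exact key _ hy.eq_of_nhds

lemma IsBoundedControl.comp_affine (hu : IsBoundedControl u) (c d : ℝ) :
    IsBoundedControl (fun t => c • u (c * t + d)) := by
  refine ⟨(hu.measurable.comp (by fun_prop)).const_smul c, ?_⟩
  obtain ⟨C, hC⟩ := hu.exists_bound
  refine ⟨|c| * C, fun t j => ?_⟩
  rw [Pi.smul_apply, smul_eq_mul, abs_mul]
  exact mul_le_mul_of_nonneg_left (hC _ _) (abs_nonneg _)

lemma IsBoundedControl.memLp (hu : IsBoundedControl u) (μ : Measure ℝ) : MemLp u ⊤ μ := by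
  obtain ⟨C, hC⟩ := hu.exists_bound
  refine memLp_top_of_bound hu.measurable.aestronglyMeasurable |C| (.of_forall fun t => ?_)
  rw [pi_norm_le_iff_of_nonneg (abs_nonneg _)]
  exact fun j => (hC t j).trans (le_abs_self C)

lemma IsRegularTrajectory.congr {a b : ℝ} (hx : IsRegularTrajectory f a b u x)
    {v : ℝ → Fin s → ℝ} {y : ℝ → M} (hxy : ∀ t ∈ Icc a b, y t = x t)
    (huv : ∀ t ∈ Ioo a b, v t = u t) : IsRegularTrajectory f a b v y := by
  obtain ⟨S, hS, hxS⟩ := hx.exists_countable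
  refine ⟨hx.continuousOn.congr hxy, S, hS, fun t ht => ?_⟩
  rw [huv t ht.1]
  refine (hxS t ht).congr ?_
  filter_upwards [isOpen_Ioo.mem_nhds ht.1] with τ hτ
  exact hxy τ (Ioo_subset_Icc_self hτ)

lemma IsRegularTrajectory.glue {a b c : ℝ} (hab : a ≤ b) (hbc : b ≤ c)
    (h₁ : IsRegularTrajectory f a b u x) (h₂ : IsRegularTrajectory f b c u x) :
    IsRegularTrajectory f a c u x := by
  obtain ⟨S₁, hS₁, hx₁⟩ := h₁.exists_countable
  obtain ⟨S₂, hS₂, hx₂⟩ := h₂.exists_countable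
  refine ⟨?_, S₁ ∪ S₂ ∪ {b}, (hS₁.union hS₂).union (countable_singleton b), ?_⟩
  · rw [← Icc_union_Icc_eq_Icc hab hbc]
    exact h₁.continuousOn.union_of_isClosed h₂.continuousOn isClosed_Icc isClosed_Icc
  · rintro t ⟨ht, htS⟩
    simp only [mem_union, mem_singleton_iff, not_or] at htS
    rcases lt_or_gt_of_ne htS.2 with h | h
    · exact hx₁ t ⟨⟨ht.1, h⟩, htS.1.1⟩
    · exact hx₂ t ⟨⟨h, ht.2⟩, htS.1.2⟩

lemma IsRegularTrajectory.comp_affine {a b a' b' c d : ℝ} (hx : IsRegularTrajectory f a b u x)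
    (hc : c ≠ 0) (hIcc : MapsTo (fun t => c * t + d) (Icc a' b') (Icc a b))
    (hIoo : MapsTo (fun t => c * t + d) (Ioo a' b') (Ioo a b)) :
    IsRegularTrajectory f a' b' (fun t => c • u (c * t + d)) (fun t => x (c * t + d)) := by
  obtain ⟨S, hS, hxS⟩ := hx.exists_countable
  refine ⟨hx.continuousOn.comp (by fun_prop) hIcc, (fun t => c * t + d) ⁻¹' S,
    hS.preimage_of_injOn (fun t _ t' _ h => by simpa [hc] using h), fun t ht => ?_⟩
  have h := (hxS (c * t + d) ⟨hIoo ht.1, ht.2⟩).comp_affine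
  convert h using 2
  rw [Finset.smul_sum]
  exact Finset.sum_congr rfl fun j _ => mul_smul _ _ _

variable [IsManifold (𝓡 n) ∞ M]

/-- In a chart a regular trajectory with bounded control is Lipschitz: its velocity is bounded,
and it is the integral of its velocity. -/
lemma IsRegularTrajectory.exists_lipschitzOnWith (hf : ∀ j, IsSmooth (f j)) {a b : ℝ}
    (hx : IsRegularTrajectory f a b u x) (hu : IsBoundedControl u) (p : M)
    (hp : MapsTo x (Icc a b) (extChartAt (𝓡 n) p).source) :
    ∃ L, LipschitzOnWith L (fun t => extChartAt (𝓡 n) p (x t)) (Icc a b) := by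
  set y := fun t => extChartAt (𝓡 n) p (x t) with hy
  have hyc : ContinuousOn y (Icc a b) := (continuousOn_extChartAt p).comp hx.continuousOn hp
  have hyt : ∀ t ∈ Icc a b, y t ∈ (extChartAt (𝓡 n) p).target :=
    fun t ht => (extChartAt (𝓡 n) p).map_source (hp ht)
  have hbound : ∀ j, ∃ D, ∀ t ∈ Icc a b, ‖chartField p (f j) (y t)‖ ≤ D := fun j =>
    isCompact_Icc.exists_bound_of_continuousOn
      (((hf j).contDiffOn_chartField p).continuousOn.comp hyc hyt)
  choose D hD using hbound
  obtain ⟨C, hC⟩ := hu.exists_bound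
  obtain ⟨S, hS, hxS⟩ := hx.exists_countable
  have hderiv : ∀ t ∈ Ioo a b \ S, HasDerivAt y (deriv y t) t ∧ ‖deriv y t‖ ≤ ∑ j, C * D j := by
    intro t ht
    have h := HasVelocityAt.hasDerivAt_extChartAt (hxS t ht) p (hp (Ioo_subset_Icc_self ht.1))
    refine ⟨h.deriv ▸ h, ?_⟩
    rw [h.deriv]
    refine norm_sum_le_of_le _ fun j _ => ?_
    rw [norm_smul]
    exact mul_le_mul (hC t j) (hD j t (Ioo_subset_Icc_self ht.1)) (norm_nonneg _)
      ((abs_nonneg _).trans (hC t j))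
  have hL : ∀ t₁ ∈ Icc a b, ∀ t₂ ∈ Icc a b, t₁ ≤ t₂ →
      ‖y t₂ - y t₁‖ ≤ (∑ j, C * D j) * |t₂ - t₁| := by
    intro t₁ ht₁ t₂ ht₂ h12
    have hsub : Icc t₁ t₂ ⊆ Icc a b := Icc_subset_Icc ht₁.1 ht₂.2
    have hsub' : Ioo t₁ t₂ ⊆ Ioo a b := Ioo_subset_Ioo ht₁.1 ht₂.2
    have hae : ∀ᵐ t, t ∈ Ioc t₁ t₂ → ‖deriv y t‖ ≤ ∑ j, C * D j := by
      filter_upwards [hS.ae_notMem volume, (countable_singleton t₂).ae_notMem volume]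
        with t htS ht2 ht
      exact (hderiv t ⟨hsub' ⟨ht.1, ht.2.lt_of_ne ht2⟩, htS⟩).2
    rw [← integral_eq_of_hasDerivAt_off_countable_of_le y (deriv y) h12 hS (hyc.mono hsub)
      (fun t ht => (hderiv t ⟨hsub' ht.1, ht.2⟩).1)]
    · exact intervalIntegral.norm_integral_le_of_norm_le_const_ae (by rwa [uIoc_of_le h12])
    · rw [intervalIntegrable_iff_integrableOn_Ioc_of_le h12]
      exact Measure.integrableOn_of_bounded (by simp) (aestronglyMeasurable_deriv _ _)
        ((ae_restrict_iff' measurableSet_Ioc).2 hae)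
  refine ⟨(∑ j, C * D j).toNNReal, LipschitzOnWith.of_dist_le_mul fun t₁ ht₁ t₂ ht₂ => ?_⟩
  rw [dist_eq_norm, Real.dist_eq]
  have hle : (∑ j, C * D j) * |t₁ - t₂| ≤ (∑ j, C * D j).toNNReal * |t₁ - t₂| :=
    mul_le_mul_of_nonneg_right (Real.le_coe_toNNReal _) (abs_nonneg _)
  rcases le_total t₁ t₂ with h | h
  · rw [norm_sub_rev]
    refine (hL t₁ ht₁ t₂ ht₂ h).trans ?_
    rwa [abs_sub_comm]
  · exact (hL t₂ ht₂ t₁ ht₁ h).trans hle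

lemma IsRegularTrajectory.isTrajectory (hf : ∀ j, IsSmooth (f j)) {T : ℝ}
    (hx : IsRegularTrajectory f 0 T u x) (hu : IsBoundedControl u) : IsTrajectory f T u x := by
  refine ⟨hx.continuousOn, fun p a b ha hab hb hp => ?_, ?_⟩
  · obtain ⟨S, hS, hxS⟩ := hx.exists_countable
    have hx' : IsRegularTrajectory f a b u x :=
      ⟨hx.continuousOn.mono (Icc_subset_Icc ha hb), S, hS,
        fun t ht => hxS t ⟨Ioo_subset_Ioo ha hb ht.1, ht.2⟩⟩
    obtain ⟨L, hL⟩ := hx'.exists_lipschitzOnWith hf hu p hp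
    exact LipschitzOnWith.absolutelyContinuousOnInterval (by rwa [uIcc_of_le hab])
  · obtain ⟨S, hS, hxS⟩ := hx.exists_countable
    rw [ae_restrict_iff' measurableSet_Icc]
    filter_upwards [hS.ae_notMem volume, (countable_singleton (0 : ℝ)).ae_notMem volume,
      (countable_singleton T).ae_notMem volume] with t htS ht0 htT ht
    exact hxS t ⟨⟨ht.1.lt_of_ne (Ne.symm ht0), ht.2.lt_of_ne htT⟩, htS⟩

end Regular

/-! ### Steerability as an equivalence relation -/

section Joined

variable {n s N : ℕ} {M : Type*} [TopologicalSpace M] [ChartedSpace (EuclideanSpace ℝ (Fin n)) M]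

/-- The ensemble `α` is steered to `β` on `[0, 1]` by a bounded control, along regular
trajectories. -/
def IsSteerable (f : Fin s → VField n M) (α β : Ensemble N M) : Prop :=
  ∃ u, IsBoundedControl u ∧
    ∀ i, ∃ x, IsRegularTrajectory f 0 1 u x ∧ x 0 = α.1 i ∧ x 1 = β.1 i

variable {f : Fin s → VField n M} {α β γ : Ensemble N M}

lemma IsSteerable.symm (h : IsSteerable f α β) : IsSteerable f β α := by
  obtain ⟨u, hu, h⟩ := h
  refine ⟨_, hu.comp_affine (-1) 1, fun i => ?_⟩
  obtain ⟨x, hx, hx0, hx1⟩ := h i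
  refine ⟨_, hx.comp_affine (a' := 0) (b' := 1) (c := -1) (d := 1) (by norm_num) ?_ ?_,
    by simp [hx1], by simp [hx0]⟩
  · exact fun t ht => ⟨by linarith [ht.2], by linarith [ht.1]⟩
  · exact fun t ht => ⟨by linarith [ht.2], by linarith [ht.1]⟩

lemma IsSteerable.trans (h₁ : IsSteerable f α β) (h₂ : IsSteerable f β γ) :
    IsSteerable f α γ := by
  obtain ⟨u, hu, h₁⟩ := h₁
  obtain ⟨v, hv, h₂⟩ := h₂
  have hu' := hu.comp_affine 2 0
  have hv' := hv.comp_affine 2 (-1)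
  refine ⟨fun t => if t ≤ 1 / 2 then (2 : ℝ) • u (2 * t + 0) else (2 : ℝ) • v (2 * t + -1),
    ⟨Measurable.ite measurableSet_Iic hu'.measurable hv'.measurable, ?_⟩, fun i => ?_⟩
  · obtain ⟨C, hC⟩ := hu'.exists_bound
    obtain ⟨D, hD⟩ := hv'.exists_bound
    refine ⟨max C D, fun t j => ?_⟩
    by_cases ht : t ≤ 1 / 2
    · simp only [ht, if_true]
      exact (hC t j).trans (le_max_left _ _)
    · simp only [ht, if_false]
      exact (hD t j).trans (le_max_right _ _)
  · obtain ⟨x, hx, hx0, hx1⟩ := h₁ i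
    obtain ⟨y, hy, hy0, hy1⟩ := h₂ i
    have hx' := hx.comp_affine (a' := 0) (b' := 1 / 2) (c := 2) (d := 0) (by norm_num)
      (fun t ht => ⟨by linarith [ht.1], by linarith [ht.2]⟩)
      (fun t ht => ⟨by linarith [ht.1], by linarith [ht.2]⟩)
    have hy' := hy.comp_affine (a' := 1 / 2) (b' := 1) (c := 2) (d := -1) (by norm_num)
      (fun t ht => ⟨by linarith [ht.1], by linarith [ht.2]⟩)
      (fun t ht => ⟨by linarith [ht.1], by linarith [ht.2]⟩)
    refine ⟨fun t => if t ≤ 1 / 2 then x (2 * t + 0) else y (2 * t + -1),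
      IsRegularTrajectory.glue (b := 1 / 2) (by norm_num) (by norm_num)
        (hx'.congr (fun t ht => if_pos ht.2) (fun t ht => if_pos ht.2.le))
        (hy'.congr (fun t ht => ?_) (fun t ht => if_neg (not_le.2 ht.1))), ?_, ?_⟩
    · rcases ht.1.eq_or_lt with h | h
      · subst h
        norm_num [hx1, hy0]
      · exact if_neg (not_le.2 h)
    · norm_num [hx0]
    · norm_num [hy1]

/-- Steering in a prescribed time, by rescaling the time and the control. -/
lemma IsSteerable.mem_attainableSet [IsManifold (𝓡 n) ∞ M] (hf : ∀ j, IsSmooth (f j))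
    (h : IsSteerable f α β) {T : ℝ} (hT : 0 < T) : β ∈ attainableSet f T α := by
  obtain ⟨u, hu, h⟩ := h
  have hu' := hu.comp_affine T⁻¹ 0
  refine ⟨_, hu'.memLp _, fun i => ?_⟩
  obtain ⟨x, hx, hx0, hx1⟩ := h i
  refine ⟨_, (hx.comp_affine (a' := 0) (b' := T) (c := T⁻¹) (d := 0) (inv_ne_zero hT.ne')
    ?_ ?_).isTrajectory hf hu', by simp [hx0], by simp [hx1, hT.ne']⟩
  · intro t ht
    refine ⟨by have := ht.1; positivity, ?_⟩
    simpa [inv_mul_le_iff₀ hT] using ht.2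
  · intro t ht
    refine ⟨by have := ht.1; positivity, ?_⟩
    simpa [inv_mul_lt_iff₀ hT] using ht.2

end Joined

/-! ### Orbits in the space of ensembles are open -/

section Orbit

variable {n s N : ℕ} {M : Type*} [TopologicalSpace M] [ChartedSpace (EuclideanSpace ℝ (Fin n)) M]

lemma IsSteerable.refl (f : Fin s → VField n M) (α : Ensemble N M) : IsSteerable f α α := by
  refine ⟨fun _ => 0, ⟨measurable_const, 0, by simp⟩, fun i => ⟨fun _ => α.1 i,
    ⟨continuousOn_const, ∅, countable_empty, fun t _ => ?_⟩, rfl, rfl⟩⟩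
  refine (hasMFDerivAt_const (α.1 i) t).congr_mfderiv (ContinuousLinearMap.ext_ring ?_)
  refine Eq.trans ?_ (one_smul ℝ _).symm
  simp only [Pi.zero_apply, zero_smul, Finset.sum_const_zero]
  rfl

/-- The representation of the `N`-fold of `X` in the product of the charts at the points of `γ`. -/
noncomputable def chartFold (γ : Ensemble N M) (X : VField n M)
    (x : Fin N → EuclideanSpace ℝ (Fin n)) : Fin N → EuclideanSpace ℝ (Fin n) :=
  fun i => chartField (γ.1 i) X (x i)

/-- The inverse of the product of the charts at the points of `γ`. -/
noncomputable def chartFoldSymm (γ : Ensemble N M) (x : Fin N → EuclideanSpace ℝ (Fin n)) :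
    Fin N → M :=
  fun i => (extChartAt (𝓡 n) (γ.1 i)).symm (x i)

/-- The points of the product of the charts at the points of `γ` that represent injective
ensembles. -/
def chartDomain (γ : Ensemble N M) : Set (Fin N → EuclideanSpace ℝ (Fin n)) :=
  (univ.pi fun i => (extChartAt (𝓡 n) (γ.1 i)).target) ∩
    chartFoldSymm γ ⁻¹' {σ | Function.Injective σ}

lemma isOpen_setOf_injective [T2Space M] : IsOpen {σ : Fin N → M | Function.Injective σ} := by
  have : {σ : Fin N → M | Function.Injective σ} =
      ⋂ (i : Fin N) (k : Fin N) (_ : i ≠ k), {σ | σ i ≠ σ k} := by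
    ext σ
    simp only [mem_ofPred_eq, mem_iInter]
    exact ⟨fun h i k hik => h.ne hik, fun h i k => not_imp_not.1 (h i k)⟩
  rw [this]
  refine isOpen_iInter_of_finite fun i => isOpen_iInter_of_finite fun k =>
    isOpen_iInter_of_finite fun _ => ?_
  exact isOpen_ne_fun (continuous_apply i) (continuous_apply k)

lemma isOpen_chartDomain [T2Space M] (γ : Ensemble N M) : IsOpen (chartDomain (n := n) γ) := by
  refine ContinuousOn.isOpen_inter_preimage ?_
    (isOpen_set_pi finite_univ fun i _ => isOpen_extChartAt_target (γ.1 i)) isOpen_setOf_injective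
  refine continuousOn_pi.2 fun i => ?_
  exact (continuousOn_extChartAt_symm (γ.1 i)).comp (continuous_apply i).continuousOn
    fun x hx => hx i (mem_univ i)

lemma self_mem_chartDomain (γ : Ensemble N M) :
    (fun i => extChartAt (𝓡 n) (γ.1 i) (γ.1 i)) ∈ chartDomain (n := n) γ := by
  refine ⟨fun i _ => mem_extChartAt_target (γ.1 i), ?_⟩
  have : chartFoldSymm (n := n) γ (fun i => extChartAt (𝓡 n) (γ.1 i) (γ.1 i)) = γ.1 :=
    funext fun i => extChartAt_to_inv (I := 𝓡 n) (γ.1 i)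
  rw [mem_preimage, this]
  exact γ.2

variable [IsManifold (𝓡 n) ∞ M]

lemma IsSmooth.contDiffAt_chartFold {X : VField n M} (hX : IsSmooth X) (γ : Ensemble N M)
    {x : Fin N → EuclideanSpace ℝ (Fin n)} (hx : x ∈ chartDomain γ) :
    ContDiffAt ℝ ∞ (chartFold γ X) x := by
  refine contDiffAt_pi.2 fun i => ?_
  have h := (hX.contDiffOn_chartField (γ.1 i)).contDiffAt
    ((isOpen_extChartAt_target (γ.1 i)).mem_nhds (hx.1 i (mem_univ i)))
  exact h.comp x (contDiff_apply ℝ _ i).contDiffAt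

lemma fderiv_chartFold_apply {X : VField n M} (hX : IsSmooth X) (γ : Ensemble N M)
    {x : Fin N → EuclideanSpace ℝ (Fin n)} (hx : x ∈ chartDomain γ)
    (v : Fin N → EuclideanSpace ℝ (Fin n)) (i : Fin N) :
    fderiv ℝ (chartFold γ X) x v i = fderiv ℝ (chartField (γ.1 i) X) (x i) (v i) := by
  have h1 : HasFDerivAt (chartField (γ.1 i) X) (fderiv ℝ (chartField (γ.1 i) X) (x i)) (x i) :=
    (((hX.contDiffOn_chartField (γ.1 i)).contDiffAt ((isOpen_extChartAt_target (γ.1 i)).mem_nhds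
      (hx.1 i (mem_univ i)))).differentiableAt (by simp)).hasFDerivAt
  have hproj : ∀ y, HasFDerivAt (fun z : Fin N → EuclideanSpace ℝ (Fin n) => z i)
      (ContinuousLinearMap.proj i : _ →L[ℝ] _) y := fun y => hasFDerivAt_apply i y
  have h2 := h1.comp x (hproj x)
  have h3 := (hproj _).comp x
    ((hX.contDiffAt_chartFold γ hx).differentiableAt (by simp)).hasFDerivAt
  exact DFunLike.congr_fun (h3.unique h2) v

lemma chartFold_mlieBracket {X Y : VField n M} (hX : IsSmooth X) (hY : IsSmooth Y)
    (γ : Ensemble N M) {x : Fin N → EuclideanSpace ℝ (Fin n)} (hx : x ∈ chartDomain γ) :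
    chartFold γ (VectorField.mlieBracket (𝓡 n) X Y) x =
      VectorField.lieBracket ℝ (chartFold γ X) (chartFold γ Y) x := by
  ext1 i
  rw [chartFold, chartField_mlieBracket hX hY _ (hx.1 i (mem_univ i)), VectorField.lieBracket,
    VectorField.lieBracket, Pi.sub_apply, fderiv_chartFold_apply hY γ hx,
    fderiv_chartFold_apply hX γ hx]
  rfl

lemma IsIteratedBracket.isSmooth {f : Fin s → VField n M} (hf : ∀ j, IsSmooth (f j))
    {X : VField n M} (hX : IsIteratedBracket f X) : IsSmooth X := by
  induction hX with
  | base j => exact hf j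
  | bracket j X _ ih => exact (hf j).mlieBracket ih

/-- Multiplication by a bump function extends a chart representation to a smooth compactly
supported field. -/
lemma exists_contDiff_eqOn_ball [T2Space M] (γ : Ensemble N M) :
    ∃ r > 0, Metric.ball (fun i => extChartAt (𝓡 n) (γ.1 i) (γ.1 i)) r ⊆ chartDomain γ ∧
      ∀ X : VField n M, IsSmooth X → ∃ G, ContDiff ℝ ∞ G ∧ HasCompactSupport G ∧
        EqOn G (chartFold γ X) (Metric.ball (fun i => extChartAt (𝓡 n) (γ.1 i) (γ.1 i)) r) := by
  set x₀ : Fin N → EuclideanSpace ℝ (Fin n) := fun i => extChartAt (𝓡 n) (γ.1 i) (γ.1 i)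
  obtain ⟨R, hR, hRsub⟩ := Metric.nhds_basis_closedBall.mem_iff.1
    ((isOpen_chartDomain γ).mem_nhds (self_mem_chartDomain (n := n) γ))
  let χ : ContDiffBump x₀ := ⟨R / 2, R, by positivity, by linarith⟩
  have hball : Metric.ball x₀ (R / 2) ⊆ Metric.closedBall x₀ R :=
    Metric.ball_subset_closedBall.trans (Metric.closedBall_subset_closedBall (by linarith))
  refine ⟨R / 2, by positivity, hball.trans hRsub, fun X hX => ⟨fun x => χ x • chartFold γ X x,
    ?_, χ.hasCompactSupport.smul_right, fun x hx => ?_⟩⟩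
  · rw [contDiff_iff_contDiffAt]
    intro x
    by_cases hx : x ∈ Metric.closedBall x₀ R
    · exact χ.contDiffAt.smul (hX.contDiffAt_chartFold γ (hRsub hx))
    · have h0 : (fun x => χ x • chartFold γ X x) =ᶠ[𝓝 x] fun _ => 0 := by
        filter_upwards [Metric.isClosed_closedBall.isOpen_compl.mem_nhds hx] with y hy
        rw [χ.zero_of_le_dist (lt_of_not_ge fun h => hy h).le, zero_smul]
      exact contDiffAt_const.congr_of_eventuallyEq h0
  · beta_reduce
    rw [χ.one_of_mem_closedBall (Metric.ball_subset_closedBall hx), one_smul]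

/-- Iterated brackets are represented by iterated brackets in the chart. -/
lemma IsIteratedBracket.exists_isLieIterate {f : Fin s → VField n M} (hf : ∀ j, IsSmooth (f j))
    (γ : Ensemble N M) {G : Fin s → (Fin N → EuclideanSpace ℝ (Fin n)) →
      Fin N → EuclideanSpace ℝ (Fin n)} {B : Set (Fin N → EuclideanSpace ℝ (Fin n))}
    (hB : IsOpen B) (hBγ : B ⊆ chartDomain γ) (hG : ∀ j, EqOn (G j) (chartFold γ (f j)) B)
    {X : VField n M} (hX : IsIteratedBracket f X) :
    ∃ Z, IsLieIterate G Z ∧ EqOn Z (chartFold γ X) B := by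
  induction hX with
  | base j => exact ⟨G j, .base j, hG j⟩
  | bracket j X hX ih =>
    obtain ⟨Z, hZ, hZX⟩ := ih
    refine ⟨_, .bracket j Z hZ, fun x hx => ?_⟩
    rw [chartFold_mlieBracket (hf j) (hX.isSmooth hf) γ (hBγ hx)]
    exact Filter.EventuallyEq.lieBracket_vectorField_eq
      ((hG j).eventuallyEq_of_mem (hB.mem_nhds hx)) (hZX.eventuallyEq_of_mem (hB.mem_nhds hx))

/-- The bracket generating condition is invariant under passing to a chart. -/
lemma NFoldsBracketGeneratingAt.span_chartFold {f : Fin s → VField n M} (γ : Ensemble N M)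
    {x : Fin N → EuclideanSpace ℝ (Fin n)} (hx : x ∈ chartDomain γ)
    (h : NFoldsBracketGeneratingAt f (⟨chartFoldSymm γ x, hx.2⟩ : Ensemble N M)) :
    Submodule.span ℝ {v | ∃ X, IsIteratedBracket f X ∧ v = chartFold γ X x} = ⊤ := by
  let D : ((i : Fin N) → TangentSpace (𝓡 n) (chartFoldSymm γ x i)) →ₗ[ℝ]
      (Fin N → EuclideanSpace ℝ (Fin n)) :=
    LinearMap.pi fun i => (mfderiv 𝓘(ℝ, EuclideanSpace ℝ (Fin n)) (𝓡 n)
      (extChartAt (𝓡 n) (γ.1 i)).symm (x i)).inverse.toLinearMap ∘ₗ LinearMap.proj i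
  have hD : Function.Surjective D := fun w =>
    ⟨fun i => mfderiv 𝓘(ℝ, EuclideanSpace ℝ (Fin n)) (𝓡 n) (extChartAt (𝓡 n) (γ.1 i)).symm (x i)
      (w i), funext fun i => (isInvertible_mfderiv_extChartAt_symm (γ.1 i)
        (hx.1 i (mem_univ i))).inverse_apply_self (w i)⟩
  rw [eq_top_iff, ← LinearMap.range_eq_top.2 hD, LinearMap.range_eq_map, ← h, Submodule.map_span]
  refine Submodule.span_mono ?_
  rintro _ ⟨_, ⟨X, hX, rfl⟩, rfl⟩
  exact ⟨X, hX, rfl⟩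

/-- An integral curve in the chart of the `N`-fold of one of the fields `f j` is followed with the
constant control that selects this field. -/
lemma isSteerable_of_hasDerivAt {f : Fin s → VField n M} (γ : Ensemble N M) (j : Fin s)
    {c : ℝ → Fin N → EuclideanSpace ℝ (Fin n)} {t : ℝ} (ht : 0 < t)
    (hc : ∀ τ ∈ Icc 0 t, HasDerivAt c (chartFold γ (f j) (c τ)) τ)
    (hcγ : ∀ τ ∈ Icc 0 t, c τ ∈ chartDomain γ) {α β : Ensemble N M}
    (hα : α.1 = chartFoldSymm γ (c 0)) (hβ : β.1 = chartFoldSymm γ (c t)) :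
    IsSteerable f α β := by
  classical
  have hu : IsBoundedControl (fun _ : ℝ => (Pi.single j 1 : Fin s → ℝ)) :=
    ⟨measurable_const, ‖(Pi.single j 1 : Fin s → ℝ)‖,
      fun _ k => norm_le_pi_norm (Pi.single j 1 : Fin s → ℝ) k⟩
  refine ⟨_, hu.comp_affine t 0, fun i => ?_⟩
  have hv : ∀ τ ∈ Icc 0 t, HasVelocityAt
      (fun τ => (extChartAt (𝓡 n) (γ.1 i)).symm (c τ i)) τ
      (∑ k, (Pi.single j 1 : Fin s → ℝ) k • f k ((extChartAt (𝓡 n) (γ.1 i)).symm (c τ i)) :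
        TangentSpace (𝓡 n) ((extChartAt (𝓡 n) (γ.1 i)).symm (c τ i))) := by
    intro τ hτ
    have h := hasVelocityAt_extChartAt_symm (X := f j) (γ.1 i) (c := fun τ => c τ i) (t := τ)
      (a := 1) (by rw [one_smul]; exact hasDerivAt_pi.1 (hc τ hτ) i)
      ((hcγ τ hτ).1 i (mem_univ i))
    convert h using 2
    rw [Finset.sum_eq_single j (fun k _ hk => by rw [Pi.single_eq_of_ne hk, zero_smul]) (by simp),
      Pi.single_eq_same]
  have hreg : IsRegularTrajectory f 0 t (fun _ : ℝ => (Pi.single j 1 : Fin s → ℝ))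
      (fun τ => (extChartAt (𝓡 n) (γ.1 i)).symm (c τ i)) :=
    ⟨fun τ hτ => (hv τ hτ).continuousAt.continuousWithinAt, ∅, countable_empty,
      fun τ hτ => hv τ (Ioo_subset_Icc_self hτ.1)⟩
  refine ⟨_, hreg.comp_affine (a' := 0) (b' := 1) (c := t) (d := 0) ht.ne' ?_ ?_, ?_, ?_⟩
  · exact fun τ hτ => ⟨by have := hτ.1; positivity, by nlinarith [hτ.2]⟩
  · exact fun τ hτ => ⟨by have := hτ.1; positivity, by nlinarith [hτ.2]⟩
  · simp [hα, chartFoldSymm]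
  · simp [hβ, chartFoldSymm]

/-- The set of ensembles to which `γ` can be steered is a neighbourhood of `γ`. -/
theorem setOf_isSteerable_mem_nhds [T2Space M] {f : Fin s → VField n M}
    (hf : ∀ j, IsSmooth (f j)) (hgen : ∀ γ : Ensemble N M, NFoldsBracketGeneratingAt f γ)
    (γ : Ensemble N M) : {δ | IsSteerable f γ δ} ∈ 𝓝 γ := by
  set x₀ : Fin N → EuclideanSpace ℝ (Fin n) := fun i => extChartAt (𝓡 n) (γ.1 i) (γ.1 i) with hx₀
  obtain ⟨r, hr, hrγ, hext⟩ := exists_contDiff_eqOn_ball (n := n) γ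
  choose G hGs hGc hGeq using fun j => hext (f j) (hf j)
  have hspan : ∀ y ∈ Metric.ball x₀ r,
      Submodule.span ℝ {v | ∃ Z, IsLieIterate G Z ∧ v = Z y} = ⊤ := by
    intro y hy
    rw [eq_top_iff, ← (hgen _).span_chartFold γ (hrγ hy)]
    refine Submodule.span_mono ?_
    rintro _ ⟨X, hX, rfl⟩
    obtain ⟨Z, hZ, hZX⟩ := hX.exists_isLieIterate hf γ Metric.isOpen_ball hrγ hGeq
    exact ⟨Z, hZ, (hZX hy).symm⟩
  have hself : γ.1 = chartFoldSymm (n := n) γ x₀ :=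
    funext fun i => (extChartAt_to_inv (I := 𝓡 n) (γ.1 i)).symm
  let O : Set (Fin N → EuclideanSpace ℝ (Fin n)) :=
    {x | ∃ δ : Ensemble N M, δ.1 = chartFoldSymm γ x ∧ IsSteerable f γ δ}
  have hO : IsSaturated G (Metric.ball x₀ r) O := by
    intro j c t ht hc hcB
    have hst : ∀ α β : Ensemble N M, α.1 = chartFoldSymm γ (c 0) → β.1 = chartFoldSymm γ (c t) →
        IsSteerable f α β := fun α β hα hβ =>
      isSteerable_of_hasDerivAt γ j ht (fun τ hτ => hGeq j (hcB τ hτ) ▸ hc τ hτ)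
        (fun τ hτ => hrγ (hcB τ hτ)) hα hβ
    constructor
    · rintro ⟨δ, hδ, hγδ⟩
      exact ⟨⟨_, (hrγ (hcB t ⟨ht.le, le_rfl⟩)).2⟩, rfl, hγδ.trans (hst _ _ hδ rfl)⟩
    · rintro ⟨δ, hδ, hγδ⟩
      exact ⟨⟨_, (hrγ (hcB 0 ⟨le_rfl, ht.le⟩)).2⟩, rfl, hγδ.trans (hst _ _ rfl hδ).symm⟩
  have hmem : O ∈ 𝓝 x₀ := mem_nhds_of_isSaturated hGs hGc Metric.isOpen_ball hspan hO
    (Metric.mem_ball_self hr) ⟨γ, hself, .refl f γ⟩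
  have hcont : ContinuousAt
      (fun (δ : Ensemble N M) (i : Fin N) => extChartAt (𝓡 n) (γ.1 i) (δ.1 i)) γ :=
    continuousAt_pi.2 fun i => ContinuousAt.comp' (f := fun δ : Ensemble N M => δ.1 i)
      (continuousAt_extChartAt (γ.1 i))
      ((continuous_apply i).comp continuous_subtype_val).continuousAt
  have hsource : ∀ᶠ δ : Ensemble N M in 𝓝 γ, ∀ i, δ.1 i ∈ (extChartAt (𝓡 n) (γ.1 i)).source :=
    Filter.eventually_all.2 fun i =>
      ((continuous_apply i).comp continuous_subtype_val).continuousAt.eventually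
        (extChartAt_source_mem_nhds (γ.1 i))
  filter_upwards [hcont.eventually hmem, hsource] with δ hδ hδs
  obtain ⟨δ', hδ', hγδ'⟩ := hδ
  have : δ' = δ := Subtype.ext (hδ'.trans (funext fun i =>
    (extChartAt (𝓡 n) (γ.1 i)).left_inv (hδs i)))
  exact this ▸ hγδ'

end Orbit

/-! ### Moving one point at a time -/

section Connected

variable {n : ℕ} {M : Type*} [TopologicalSpace M] [ChartedSpace (EuclideanSpace ℝ (Fin n)) M]

/-- In dimension at least two, points have arbitrarily small neighbourhoods that remain connected
when the point is removed. -/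
lemma exists_isConnected_diff_singleton (hn : 2 ≤ n) {p : M} {U : Set M} (hU : U ∈ 𝓝 p) :
    ∃ V ∈ 𝓝 p, V ⊆ U ∧ IsConnected (V \ {p}) := by
  set φ := chartAt (EuclideanSpace ℝ (Fin n)) p with hφ
  have hpt : φ p ∈ φ.target := mem_chart_target _ p
  have hpinv : φ.symm (φ p) = p := φ.left_inv (mem_chart_source _ p)
  have hcont : ContinuousAt φ.symm (φ p) := φ.continuousAt_symm hpt
  obtain ⟨r, hr, hrsub⟩ := Metric.mem_nhds_iff.1
    (Filter.inter_mem (φ.open_target.mem_nhds hpt) (hcont.preimage_mem_nhds (by rwa [hpinv])))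
  -- the ball is the homeomorphic image of the whole space
  set b := OpenPartialHomeomorph.univBall (φ p) r with hb
  have hbt : b.target = Metric.ball (φ p) r := OpenPartialHomeomorph.univBall_target _ hr
  have hbc : Continuous b := OpenPartialHomeomorph.continuous_univBall _ _
  have hbmem : ∀ y, b y ∈ Metric.ball (φ p) r := fun y => hbt ▸ b.map_source (by simp [hb])
  have hbinj : Function.Injective b := fun y y' h => b.injOn (by simp [hb]) (by simp [hb]) h
  have hb0 : b 0 = φ p := OpenPartialHomeomorph.univBall_apply_zero _ _
  refine ⟨φ.symm '' Metric.ball (φ p) r, ?_, ?_, ?_⟩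
  · have := φ.symm.image_mem_nhds (by simpa using hpt) (Metric.ball_mem_nhds (φ p) hr)
    rwa [hpinv] at this
  · rintro _ ⟨y, hy, rfl⟩
    exact (hrsub hy).2
  · have hF : ContinuousOn (fun y => φ.symm (b y)) {0}ᶜ :=
      φ.continuousOn_symm.comp hbc.continuousOn fun y _ => (hrsub (hbmem y)).1
    have himage : φ.symm '' Metric.ball (φ p) r \ {p} = (fun y => φ.symm (b y)) '' {0}ᶜ := by
      ext q
      constructor
      · rintro ⟨⟨z, hz, rfl⟩, hq⟩
        obtain ⟨y, -, rfl⟩ : ∃ y ∈ b.source, b y = z :=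
          ⟨b.symm z, b.map_target (hbt ▸ hz), b.right_inv (hbt ▸ hz)⟩
        refine ⟨y, fun hy => hq ?_, rfl⟩
        rw [mem_singleton_iff.1 hy, hb0, hpinv, mem_singleton_iff]
      · rintro ⟨y, hy, rfl⟩
        refine ⟨⟨b y, hbmem y, rfl⟩, fun hq => hy ?_⟩
        have h1 : φ.symm (b y) = φ.symm (φ p) := by rw [hpinv]; exact hq
        exact hbinj ((φ.symm.injOn (hrsub (hbmem y)).1 hpt h1).trans hb0.symm)
    rw [himage]
    refine (isConnected_compl_singleton_of_one_lt_rank ?_ 0).image _ hF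
    refine Module.one_lt_rank_of_one_lt_finrank ?_
    rw [finrank_euclideanSpace_fin]
    omega

/-- A function on a connected manifold of dimension at least two that is locally constant outside
a finite set is constant outside this set: it is constant near each exceptional point, and so can
be redefined there to become locally constant. -/
lemma eq_of_forall_eventually_eq [T1Space M] [ConnectedSpace M] (hn : 2 ≤ n) {F : Set M}
    (hF : F.Finite) {α : Type*} {g : M → α} (hg : ∀ q ∉ F, ∀ᶠ q' in 𝓝 q, g q' = g q)
    {q q' : M} (hq : q ∉ F) (hq' : q' ∉ F) : g q = g q' := by
  have hnear : ∀ p, ∀ᶠ q in 𝓝[≠] p, q ∉ F := by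
    intro p
    have h1 : (F \ {p})ᶜ ∈ 𝓝 p := (hF.subset sdiff_subset).isClosed.isOpen_compl.mem_nhds (by simp)
    filter_upwards [mem_nhdsWithin_of_mem_nhds h1, self_mem_nhdsWithin] with q hq hqp hqF
    exact hq ⟨hqF, hqp⟩
  have hex : ∀ p, ∃ c, (p ∉ F → c = g p) ∧ ∀ᶠ q in 𝓝[≠] p, g q = c := by
    intro p
    by_cases hp : p ∈ F
    · obtain ⟨V, hV, hVF, hVc⟩ := exists_isConnected_diff_singleton (n := n) hn
        (mem_nhdsWithin_iff_exists_mem_nhds_inter.1 (hnear p)).choose_spec.1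
      have hVF' : ∀ q ∈ V \ {p}, q ∉ F := fun q hq =>
        (mem_nhdsWithin_iff_exists_mem_nhds_inter.1 (hnear p)).choose_spec.2 ⟨hVF hq.1, hq.2⟩
      obtain ⟨q₀, hq₀⟩ := hVc.nonempty
      refine ⟨g q₀, fun h => absurd hp h, ?_⟩
      let : TopologicalSpace α := ⊥
      have : DiscreteTopology α := ⟨rfl⟩
      have hgc : ContinuousOn g (V \ {p}) := fun q hq =>
        (continuousAt_const.congr_of_eventuallyEq (hg q (hVF' q hq))).continuousWithinAt
      filter_upwards [mem_nhdsWithin_of_mem_nhds hV, self_mem_nhdsWithin] with q hqV hqp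
      exact hVc.isPreconnected.constant hgc ⟨hqV, hqp⟩ hq₀
    · exact ⟨g p, fun _ => rfl, (hg p hp).filter_mono nhdsWithin_le_nhds⟩
  choose c hcF hc using hex
  have hloc : IsLocallyConstant c := by
    refine (IsLocallyConstant.iff_eventually_eq _).2 fun p => ?_
    have h1 : ∀ᶠ q in 𝓝[≠] p, c q = c p := by
      filter_upwards [hnear p, hc p] with q hq hqc
      rw [hcF q hq, hqc]
    filter_upwards [eventually_nhdsWithin_iff.1 h1] with q hq
    by_cases hqp : q = p
    · rw [hqp]
    · exact hq hqp
  rw [← hcF q hq, ← hcF q' hq']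
  exact hloc.apply_eq_of_preconnectedSpace q q'

lemma infinite_of_two_le [T1Space M] [Nonempty M] (hn : 2 ≤ n) : Infinite M := by
  obtain ⟨p⟩ := ‹Nonempty M›
  have : (𝓝[≠] p).NeBot := by
    refine Filter.neBot_iff.2 fun h => ?_
    obtain ⟨U, hU, hUp⟩ := mem_nhdsWithin_iff_exists_mem_nhds_inter.1
      (h ▸ Filter.mem_bot : (∅ : Set M) ∈ 𝓝[≠] p)
    obtain ⟨V, -, hVU, hV⟩ := exists_isConnected_diff_singleton (n := n) hn hU
    obtain ⟨q, hq⟩ := hV.nonempty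
    exact hUp ⟨hVU hq.1, hq.2⟩
  exact infinite_univ_iff.1 (infinite_of_mem_nhds p Filter.univ_mem)

end Connected

lemma injective_update {N : ℕ} {M : Type*} {α : Fin N → M}
    (hα : Function.Injective α) (i : Fin N) {q : M}
    (hq : q ∉ α '' {i}ᶜ) : Function.Injective (Function.update α i q) := by
  intro k l hkl
  by_cases hk : k = i <;> by_cases hl : l = i
  · rw [hk, hl]
  · subst hk
    rw [Function.update_self, Function.update_of_ne hl] at hkl
    exact absurd ⟨l, hl, hkl.symm⟩ hq
  · subst hl
    rw [Function.update_self, Function.update_of_ne hk] at hkl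
    exact absurd ⟨k, hk, hkl⟩ hq
  · rw [Function.update_of_ne hk, Function.update_of_ne hl] at hkl
    exact hα hkl

section Transitive

variable {n s N : ℕ} {M : Type*} [TopologicalSpace M] [T2Space M] [ConnectedSpace M]
  [ChartedSpace (EuclideanSpace ℝ (Fin n)) M]

variable {f : Fin s → VField n M}

/-- One point of an ensemble can be moved to any position different from the other points. -/
lemma isSteerable_update (hn : 2 ≤ n)
    (hnhds : ∀ γ : Ensemble N M, {δ | IsSteerable f γ δ} ∈ 𝓝 γ) (α : Ensemble N M) (i : Fin N)
    {q : M} (hq : q ∉ α.1 '' {i}ᶜ) :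
    IsSteerable f α ⟨Function.update α.1 i q, injective_update α.2 i hq⟩ := by
  let g : M → Prop := fun q =>
    ∃ h : Function.Injective (Function.update α.1 i q), IsSteerable f α ⟨_, h⟩
  have hfin : (α.1 '' {i}ᶜ).Finite := toFinite _
  have hg : ∀ q ∉ α.1 '' {i}ᶜ, ∀ᶠ q' in 𝓝 q, g q' = g q := by
    intro q hq
    obtain ⟨V, hV, hVs⟩ := mem_nhds_subtype _ _ _ |>.1
      (hnhds ⟨Function.update α.1 i q, injective_update α.2 i hq⟩)
    have hcont : Continuous fun q' : M => Function.update α.1 i q' :=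
      continuous_const.update i continuous_id
    filter_upwards [hcont.continuousAt.preimage_mem_nhds hV,
      hfin.isClosed.isOpen_compl.mem_nhds hq] with q' hq'V hq'
    have hst : IsSteerable f ⟨Function.update α.1 i q, injective_update α.2 i hq⟩
        ⟨Function.update α.1 i q', injective_update α.2 i hq'⟩ := hVs hq'V
    exact propext ⟨fun ⟨_, h⟩ => ⟨_, h.trans hst.symm⟩, fun ⟨_, h⟩ => ⟨_, h.trans hst⟩⟩
  have hself : α.1 i ∉ α.1 '' {i}ᶜ := by
    rintro ⟨k, hk, hki⟩
    exact hk (α.2 hki)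
  have h0 : g (α.1 i) := by
    have h1 : Function.update α.1 i (α.1 i) = α.1 := Function.update_eq_self i α.1
    refine ⟨h1.symm ▸ α.2, ?_⟩
    convert IsSteerable.refl f α using 2
  have h1 : g q := eq_of_forall_eventually_eq (n := n) hn hfin hg hself hq ▸ h0
  exact h1.2

/-- If two ensembles have no point in common, the points of the first can be moved, one after the
other, to those of the second. -/
lemma isSteerable_of_disjoint (hn : 2 ≤ n)
    (hnhds : ∀ γ : Ensemble N M, {δ | IsSteerable f γ δ} ∈ 𝓝 γ) (α γ : Ensemble N M)
    (hαγ : ∀ i k, α.1 i ≠ γ.1 k) : IsSteerable f α γ := by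
  have hinj : ∀ S : Finset (Fin N), Function.Injective (S.piecewise γ.1 α.1) := by
    intro S k l hkl
    simp only [Finset.piecewise] at hkl
    split_ifs at hkl
    · exact γ.2 hkl
    · exact absurd hkl.symm (hαγ _ _)
    · exact absurd hkl (hαγ _ _)
    · exact α.2 hkl
  have key : ∀ S : Finset (Fin N), IsSteerable f α ⟨S.piecewise γ.1 α.1, hinj S⟩ := by
    intro S
    induction S using Finset.induction_on with
    | empty =>
      convert IsSteerable.refl f α using 2
      exact Finset.piecewise_empty _ _
    | insert i S hi ih =>
      have hins : (insert i S).piecewise γ.1 α.1 =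
          Function.update (S.piecewise γ.1 α.1) i (γ.1 i) := Finset.piecewise_insert _ _ _ _
      have hq : γ.1 i ∉ (S.piecewise γ.1 α.1) '' {i}ᶜ := by
        rintro ⟨k, hk, hki⟩
        simp only [Finset.piecewise] at hki
        split_ifs at hki
        · exact hk (γ.2 hki)
        · exact hαγ _ _ hki
      convert ih.trans (isSteerable_update hn hnhds ⟨S.piecewise γ.1 α.1, hinj S⟩ i hq) using 2
  convert key Finset.univ using 2
  exact (Finset.piecewise_univ _ _).symm

/-- If orbits are neighbourhoods of their points, there is a single orbit: any two ensembles are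
joined through a third one, disjoint from both. -/
theorem isSteerable_of_forall_mem_nhds (hn : 2 ≤ n)
    (hnhds : ∀ γ : Ensemble N M, {δ | IsSteerable f γ δ} ∈ 𝓝 γ) (α β : Ensemble N M) :
    IsSteerable f α β := by
  have : Infinite M := infinite_of_two_le (n := n) hn
  have hfin : (range α.1 ∪ range β.1).Finite := toFinite _
  let e := hfin.infinite_compl.natEmbedding
  let γ : Ensemble N M := ⟨fun i => e i, fun i k h =>
    Fin.val_injective (e.injective (Subtype.val_injective h))⟩
  have hγ : ∀ i, γ.1 i ∉ range α.1 ∪ range β.1 := fun i => (e i).2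
  refine (isSteerable_of_disjoint hn hnhds α γ fun i k h => hγ k (.inl ⟨i, h⟩)).trans
    (isSteerable_of_disjoint hn hnhds β γ fun i k h => hγ k (.inr ⟨i, h⟩)).symm

end Transitive

end EnsembleControl

theorem mainTheorem4 {n : ℕ} (hn : 2 ≤ n) {M : Type*} [TopologicalSpace M] [T2Space M]
    [ConnectedSpace M] [ChartedSpace (EuclideanSpace ℝ (Fin n)) M] [IsManifold (𝓡 n) ∞ M]
    {s : ℕ} (f : Fin s → EnsembleControl.VField n M) (hf : ∀ j, EnsembleControl.IsSmooth (f j))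
    (N : ℕ)
    (hgen : ∀ γ : EnsembleControl.Ensemble N M, EnsembleControl.NFoldsBracketGeneratingAt f γ) :
    ∀ T : ℝ, 0 < T → EnsembleControl.GloballyExactlyControllable f N T := by
  intro T hT α
  refine eq_univ_of_forall fun β => ?_
  exact (EnsembleControl.isSteerable_of_forall_mem_nhds hn
    (EnsembleControl.setOf_isSteerable_mem_nhds hf hgen) α β).mem_attainableSet hf hT
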